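/- All groups are finite. Let $\sigma=\{\sigma_i\mid i\in I\}$ be a partition of the set of all primes, and let $\sigma(G)$ be the set of those $\sigma_i$ that contain a prime divisor of $|G|$. A group is *$\sigma$-primary* if it is a $\sigma_i$-group for some $i$; *$\sigma$-nilpotent* if it is a direct product of $\sigma$-primary groups; *$\sigma$-soluble* if each of its chief factors is $\sigma$-primary; *$\sigma$-full* if it has a Hall $\sigma_i$-subgroup for every $\sigma_i\in\sigma(G)$. Write $G^{\mathfrak N_\sigma}$ for the intersection of all normal subgroups $N$ of $G$ with $G/N$ $\sigma$-nilpotent. A subgroup $A$ of $G$ is *$\sigma$-subnormal* in $G$ if there is a chain $A=A_0\le A_1\le\dots\le A_n=G$ such that, for each $k$, either $A_{k-1}\trianglelefteq A_k$ or $A_k/(A_{k-1})_{A_k}$ is $\sigma$-primary, where $(A_{k-1})_{A_k}$ is the core of $A_{k-1}$ in $A_k$. It is *$\sigma$-permutable* in $G$ if either $A\trianglelefteq G$, or $G$ is $\sigma$-full and $AH=HA$ for every $\sigma_i\in\sigma(G)$ and every Hall $\sigma_i$-subgroup $H$ of $G$. The group $G$ is a *$P\sigma T$-group* if, whenever $H$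 is $\sigma$-permutable in $K$ and $K$ is $\sigma$-permutable in $G$, $H$ is $\sigma$-permutable in $G$. A *subgroup functor* $\tau$ on the class $\mathfrak X$ of all $\sigma$-full groups assigns to each $G\in\mathfrak X$ a set $\tau(G)$ of subgroups of $G$ such that $G\in\tau(G)$ and, for every epimorphism $\varphi:A\to B$ with $A,B\in\mathfrak X$ and all $H\in\tau(A)$, $T\in\tau(B)$, we have $\varphi(H)\in\tau(B)$ and $\varphi^{-1}(T)\in\tau(A)$. It is *$\sigma$-special* if for every $G\in\mathfrak X$: (\*) every $\sigma$-subnormal subgroup of $G$ that belongs to $\tau(G)$ is $\sigma$-permutable in $G$; (\*\*) $\langle A,B\rangle\in\tau(G)$ for all $\sigma$-subnormal subgroups $A,B\in\tau(G)$ of $G$; (\*\*\*) if $G=D\rtimes M$ is a $\sigma$-soluble $P\sigma T$-group with $D=G^{\mathfrak N_\sigma}$, and $A\in\tau(M)$ is $\sigma$-primary and $\sigma$-subnormal in $G$, then $A\in\tau(G)$. **Theorem 2.11.** Let $\tau$ be a $\sigma$-special subgroup functor on the class of all $\sigma$-full groups, let $G$ be a $\sigma$-soluble group and let $D=G^{\mathfrak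 N_\sigma}$. If every $\sigma$-subnormal subgroup of $G$ belongs to $\tau(G)$, then $G$ is a $P\sigma T$-group and there is a subgroup $M$ of $G$ such that the following conditions hold: (i) $G=D\rtimes M$, where $D$ is an abelian Hall subgroup of $G$ of odd order, $M$ is $\sigma$-nilpotent with $U\in\tau(M)$ for all subgroups $U$ of $M$, and every element of $G$ induces by conjugation a power automorphism of $D$ (that is, an automorphism mapping every subgroup of $D$ onto itself); (ii) for every $i\in I$, the largest normal $\sigma_i$-subgroup $O_{\sigma_i}(D)$ of $D$ has a normal complement in some Hall $\sigma_i$-subgroup of $G$. Conversely, if Conditions (i) and (ii) hold for $D=G^{\mathfrak N_\sigma}$ and some subgroup $M$ of $G$, then every $\sigma$-subnormal subgroup of $G$ belongs to $\tau(G)$. -/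

import Mathlib

open scoped Pointwise

universe u v

namespace SigmaTheory

/-- `σ` is a partition of the set of all primes: the classes `σ i` cover exactly the primes and
are pairwise disjoint. -/
def IsPrimePartition {I : Type v} (σ : I → Set ℕ) : Prop :=
  (⋃ i, σ i) = {p : ℕ | p.Prime} ∧ ∀ i j, i ≠ j → σ i ∩ σ j = ∅

/-- A (finite) group is a `π`-group if all prime divisors of its order lie in `π`.
Only the order of the group enters. -/
def IsPiGroup (π : Set ℕ) (G : Type*) : Prop :=
  ∀ p : ℕ, p.Prime → p ∣ Nat.card G → p ∈ π

/-- `G` is `σ`-primary: it is a `σ i`-group for some `i` (the trivial group is allowed). -/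
def IsSigmaPrimary {I : Type v} (σ : I → Set ℕ) (G : Type*) : Prop :=
  ∃ i, IsPiGroup (σ i) G

/-- `G` is `σ`-nilpotent: it is a (finite) direct product of `σ`-primary groups. -/
def IsSigmaNilpotent {I : Type v} (σ : I → Set ℕ) (G : Type u) [Group G] : Prop :=
  ∃ (n : ℕ) (H : Fin n → Type u) (_ : ∀ k, Group (H k)),
    (∀ k, IsSigmaPrimary σ (H k)) ∧ Nonempty (G ≃* ((k : Fin n) → H k))

/-- `H / K` is a chief factor of `G`: `K < H` are normal subgroups of `G` and no normal subgroup
of `G` lies strictly between them. -/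
def IsChiefFactor {G : Type*} [Group G] (H K : Subgroup G) : Prop :=
  H.Normal ∧ K.Normal ∧ K < H ∧ ∀ N : Subgroup G, N.Normal → K ≤ N → N ≤ H → N = K ∨ N = H

/-- `G` is `σ`-soluble: every chief factor of `G` is `σ`-primary. -/
def IsSigmaSoluble {I : Type v} (σ : I → Set ℕ) (G : Type*) [Group G] : Prop :=
  ∀ H K : Subgroup G, IsChiefFactor H K → IsSigmaPrimary σ (↥H ⧸ K.subgroupOf H)

/-- One step of a `σ`-subnormal chain: `A ≤ B`, and either `A` is normal in `B` or the quotient of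
`B` by the core of `A` in `B` is `σ`-primary. -/
def SigmaSubnormalStep {I : Type v} (σ : I → Set ℕ) {G : Type*} [Group G]
    (A B : Subgroup G) : Prop :=
  A ≤ B ∧ ((A.subgroupOf B).Normal ∨ IsSigmaPrimary σ (↥B ⧸ (A.subgroupOf B).normalCore))

/-- `A` is `σ`-subnormal in `G`: there is a finite chain of such steps from `A` to `G`. -/
def IsSigmaSubnormal {I : Type v} (σ : I → Set ℕ) {G : Type*} [Group G]
    (A : Subgroup G) : Prop :=
  Relation.ReflTransGen (SigmaSubnormalStep σ) A ⊤

/-- `H` is a Hall `π`-subgroup of `G`: a `π`-subgroup whose index is divisible by no prime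
of `π`. -/
def IsHallPi {G : Type*} [Group G] (π : Set ℕ) (H : Subgroup G) : Prop :=
  IsPiGroup π ↥H ∧ ∀ p : ℕ, p.Prime → p ∣ H.index → p ∉ π

/-- `H` is a Hall subgroup of `G`: its order and its index are coprime. -/
def IsHall {G : Type*} [Group G] (H : Subgroup G) : Prop :=
  Nat.Coprime (Nat.card ↥H) H.index

/-- `σ i ∈ σ(G)`: some prime of `σ i` divides the order of `G`. -/
def MemSigma {I : Type v} (σ : I → Set ℕ) (G : Type*) (i : I) : Prop :=
  ∃ p ∈ σ i, p ∣ Nat.card G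

/-- `G` is `σ`-full: it has a Hall `σ i`-subgroup for every `σ i ∈ σ(G)`. -/
def IsSigmaFull {I : Type v} (σ : I → Set ℕ) (G : Type*) [Group G] : Prop :=
  ∀ i, MemSigma σ G i → ∃ H : Subgroup G, IsHallPi (σ i) H

/-- `A` permutes with `B`: `AB = BA`. -/
def Permutes {G : Type*} [Group G] (A B : Subgroup G) : Prop :=
  (A : Set G) * (B : Set G) = (B : Set G) * (A : Set G)

/-- `A` is `σ`-permutable in `G`: either `A` is normal in `G`, or `G` is `σ`-full and `A` permutes
with every Hall `σ i`-subgroup of `G`, for every `σ i ∈ σ(G)`. -/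
def IsSigmaPermutable {I : Type v} (σ : I → Set ℕ) {G : Type*} [Group G]
    (A : Subgroup G) : Prop :=
  A.Normal ∨ (IsSigmaFull σ G ∧
    ∀ i, MemSigma σ G i → ∀ H : Subgroup G, IsHallPi (σ i) H → Permutes A H)

/-- `G` is a `PσT`-group: `σ`-permutability is transitive in `G`. -/
def IsPSigmaTGroup {I : Type v} (σ : I → Set ℕ) (G : Type*) [Group G] : Prop :=
  ∀ (K : Subgroup G) (H : Subgroup ↥K), IsSigmaPermutable σ H → IsSigmaPermutable σ K →
    IsSigmaPermutable σ (H.map K.subtype)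

/-- The `σ`-nilpotent residual of `G`: the intersection of all normal subgroups `N` of `G` with
`σ`-nilpotent quotient `G / N`. -/
def sigmaNilpotentResidual {I : Type v} (σ : I → Set ℕ) (G : Type u) [Group G] : Subgroup G :=
  sInf {N : Subgroup G | ∃ _ : N.Normal, IsSigmaNilpotent σ (G ⧸ N)}

/-- `G = D ⋊ M` (internal semidirect product): `D` is normal in `G` and `M` is a complement
of `D` in `G`. -/
def IsSemidirect {G : Type*} [Group G] (D M : Subgroup G) : Prop :=
  D.Normal ∧ Subgroup.IsComplement' D M

/-- `O_π(G)`: the subgroup generated by all normal `π`-subgroups of `G`. -/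
def piCore (π : Set ℕ) (G : Type*) [Group G] : Subgroup G :=
  sSup {N : Subgroup G | N.Normal ∧ IsPiGroup π ↥N}

/-- `O` is a subgroup of `H` that has a normal complement in `H`. -/
def HasNormalComplementIn {G : Type*} [Group G] (O H : Subgroup G) : Prop :=
  O ≤ H ∧ ∃ S : Subgroup ↥H, S.Normal ∧ Subgroup.IsComplement' S (O.subgroupOf H)

/-- A power automorphism of a group maps every subgroup onto itself. -/
def IsPowerAutomorphism {G : Type*} [Group G] (α : MulAut G) : Prop :=
  ∀ K : Subgroup G, K.map α.toMonoidHom = K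

/-- An assignment of a set `τ(G)` of subgroups to every group `G`. It is constrained, and used,
only on finite `σ`-full groups. -/
abbrev SubgroupSystem : Type (u + 1) :=
  (G : Type u) → [Group G] → Set (Subgroup G)

/-- `τ` is a subgroup functor in the sense of Skiba on the class of finite `σ`-full groups. -/
structure IsSubgroupFunctor {I : Type v} (σ : I → Set ℕ) (τ : SubgroupSystem.{u}) : Prop where
  top_mem : ∀ (G : Type u) [Group G] [Finite G], IsSigmaFull σ G → (⊤ : Subgroup G) ∈ τ G
  map_mem : ∀ (A B : Type u) [Group A] [Finite A] [Group B] [Finite B],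
    IsSigmaFull σ A → IsSigmaFull σ B → ∀ φ : A →* B, Function.Surjective φ →
      ∀ H ∈ τ A, H.map φ ∈ τ B
  comap_mem : ∀ (A B : Type u) [Group A] [Finite A] [Group B] [Finite B],
    IsSigmaFull σ A → IsSigmaFull σ B → ∀ φ : A →* B, Function.Surjective φ →
      ∀ T ∈ τ B, T.comap φ ∈ τ A

/-- The subgroup functor `τ` on the class of finite `σ`-full groups is `σ`-special. -/
structure IsSigmaSpecial {I : Type v} (σ : I → Set ℕ) (τ : SubgroupSystem.{u}) : Prop
    extends IsSubgroupFunctor σ τ where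
  permutable : ∀ (G : Type u) [Group G] [Finite G], IsSigmaFull σ G →
    ∀ A : Subgroup G, IsSigmaSubnormal σ A → A ∈ τ G → IsSigmaPermutable σ A
  sup_mem : ∀ (G : Type u) [Group G] [Finite G], IsSigmaFull σ G →
    ∀ A B : Subgroup G, IsSigmaSubnormal σ A → IsSigmaSubnormal σ B →
      A ∈ τ G → B ∈ τ G → A ⊔ B ∈ τ G
  lift_mem : ∀ (G : Type u) [Group G] [Finite G], IsSigmaFull σ G →
    IsSigmaSoluble σ G → IsPSigmaTGroup σ G →
    ∀ M : Subgroup G, IsSemidirect (sigmaNilpotentResidual σ G) M →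
    ∀ A : Subgroup ↥M, IsSigmaPrimary σ ↥A → IsSigmaSubnormal σ (A.map M.subtype) →
      A ∈ τ ↥M → A.map M.subtype ∈ τ G

/-- The structural conditions on subgroups `D` and `M` of `G`. -/
structure StructureConditions {I : Type v} (σ : I → Set ℕ) (τ : SubgroupSystem.{u})
    {G : Type u} [Group G] (D M : Subgroup G) : Prop where
  [normal : D.Normal]
  semidirect : IsSemidirect D M
  abelian : ∀ x ∈ D, ∀ y ∈ D, x * y = y * x
  hall : IsHall D
  odd : Odd (Nat.card ↥D)
  nilpotent : IsSigmaNilpotent σ ↥M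
  mem : ∀ U : Subgroup ↥M, U ∈ τ ↥M
  power : ∀ g : G, IsPowerAutomorphism (MulAut.conjNormal g : MulAut ↥D)
  complement : ∀ i, ∃ H : Subgroup G, IsHallPi (σ i) H ∧
    HasNormalComplementIn ((piCore (σ i) ↥D).map D.subtype) H

end SigmaTheory

open SigmaTheory

/-!
For `σ`-soluble `G` the residual `D` is generated by the commutators `⁅x, y⁆` of a `p`-element `x`
and a `q`-element `y` whose primes lie in different classes of `σ`.

If every `σ`-subnormal subgroup belongs to `τ`, then by (*) it permutes with the Hall
`σ i`-subgroups of `G`. Applied to subgroups of a normal `σ i`-section, this forces the elements of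
order prime to `σ i` to normalise all of them. So `D` centralises every chief factor inside it and
is nilpotent, and modulo its `p'`-part some `g` normalises every subgroup of a Sylow `p`-subgroup
`P` and fixes no nontrivial element of `D`. A power action with one nontrivial fixed point is
trivial on `P`, whence every element of `P` is a commutator `⁅y, g⁆` and `P = D`. Hence `D` is a
Hall subgroup, of odd order because `g` would fix an involution. Every commutator `⁅y, g⁆` induces
a power automorphism of the `σ i`-elements, from which `D` is abelian and (ii) follows.

Conversely, let `A` be `σ`-subnormal. Passing to the quotient by `A ⊓ D`, which is normal in `G`,
one may assume that `A` meets `D` trivially. Then `A` centralises `D`, so its `σ i`-parts lie in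
every complement of `D`. They belong to `τ G` by (***), and `A` is their join by (**).
-/

open scoped commutatorElement

namespace SigmaTheory

/-! ### `p`-elements and the subgroups they generate -/

section Elements

variable {G G' : Type*} [Group G] [Group G'] {p q : ℕ} {π : Set ℕ}

/-- `x` is a `p`-element: its order is a power of `p`. -/
def IsPElement (p : ℕ) (x : G) : Prop := ∃ k : ℕ, x ^ p ^ k = 1

/-- `n` is a `π`-number: all its prime divisors lie in `π`. A group `G` is a `π`-group exactly
when `Nat.card G` is a `π`-number, definitionally. -/
def IsPiNumber (π : Set ℕ) (n : ℕ) : Prop := ∀ p : ℕ, p.Prime → p ∣ n → p ∈ π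

theorem IsPiNumber.of_dvd {m n : ℕ} (h : IsPiNumber π n) (hmn : m ∣ n) : IsPiNumber π m :=
  fun p hp hd => h p hp (hd.trans hmn)

theorem IsPiNumber.mul {m n : ℕ} (hm : IsPiNumber π m) (hn : IsPiNumber π n) :
    IsPiNumber π (m * n) :=
  fun p hp hd => (hp.dvd_mul.1 hd).elim (hm p hp) (hn p hp)

theorem IsPiNumber.coprime {m n : ℕ} (hm : IsPiNumber π m)
    (hn : ∀ p : ℕ, p.Prime → p ∣ n → p ∉ π) : m.Coprime n :=
  Nat.coprime_of_dvd fun p hp hpm hpn => hn p hp hpn (hm p hp hpm)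

theorem IsPiNumber.eq_one {n : ℕ} (h : IsPiNumber ∅ n) : n = 1 := by
  by_contra hn
  exact h _ (Nat.minFac_prime hn) n.minFac_dvd

theorem IsPElement.map {x : G} (h : IsPElement p x) (f : G →* G') : IsPElement p (f x) :=
  h.imp fun k hk => by rw [← map_pow, hk, map_one]

theorem isPElement_map_iff {f : G →* G'} (hf : Function.Injective f) {x : G} :
    IsPElement p (f x) ↔ IsPElement p x :=
  exists_congr fun k => by rw [← map_pow, map_eq_one_iff f hf]

theorem isPElement_coe_iff {K : Subgroup G} {x : K} : IsPElement p (x : G) ↔ IsPElement p x :=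
  isPElement_map_iff (f := K.subtype) K.subtype_injective

theorem IsPElement.inv {x : G} (h : IsPElement p x) : IsPElement p x⁻¹ :=
  h.imp fun k hk => by rw [inv_pow, hk, inv_one]

theorem IsPElement.zpow {x : G} (h : IsPElement p x) (n : ℤ) : IsPElement p (x ^ n) :=
  h.imp fun k hk => by rw [← zpow_natCast, zpow_comm, zpow_natCast, hk, one_zpow]

theorem IsPElement.conj {x : G} (h : IsPElement p x) (g : G) : IsPElement p (g * x * g⁻¹) :=
  h.map (MulAut.conj g).toMonoidHom

theorem isPElement_of_mem {K : Subgroup G} (hK : IsPGroup p K) {x : G} (hx : x ∈ K) :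
    IsPElement p x :=
  isPElement_coe_iff.2 (hK ⟨x, hx⟩)

theorem IsPElement.isPGroup_zpowers {x : G} (h : IsPElement p x) :
    IsPGroup p (Subgroup.zpowers x) := by
  rintro ⟨_, n, rfl⟩
  exact isPElement_coe_iff.1 (h.zpow n)

theorem IsPElement.eq_one_of_not_dvd (hp : p.Prime) {x : G} (h : IsPElement p x)
    {n : ℕ} (hx : x ^ n = 1) (hn : ¬ p ∣ n) : x = 1 := by
  obtain ⟨k, hk⟩ := h
  have hc : (p ^ k).Coprime n := Nat.Coprime.pow_left _ ((hp.coprime_iff_not_dvd).2 hn)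
  exact orderOf_eq_one_iff.1 (Nat.eq_one_of_dvd_coprimes hc (orderOf_dvd_of_pow_eq_one hk)
    (orderOf_dvd_of_pow_eq_one hx))

theorem IsPElement.eq_one_of_ne (hp : p.Prime) (hq : q.Prime) (hpq : p ≠ q) {x : G}
    (h : IsPElement p x) (h' : IsPElement q x) : x = 1 := by
  obtain ⟨k, hk⟩ := h'
  exact h.eq_one_of_not_dvd hp hk fun hd => hpq ((Nat.prime_dvd_prime_iff_eq hp hq).1
    (hp.dvd_of_dvd_pow hd))

/-- A suitable power of a preimage `x` works: choose the exponent `≡ 1` modulo the order of `y` and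
divisible by the `p'`-part of the order of `x`. -/
theorem IsPElement.exists_lift [Finite G] (hp : p.Prime) {f : G →* G'}
    (hf : Function.Surjective f) {y : G'} (hy : IsPElement p y) :
    ∃ x : G, IsPElement p x ∧ f x = y := by
  obtain ⟨x, rfl⟩ := hf y
  obtain ⟨k, hk⟩ := hy
  obtain ⟨a, m, hm, hx⟩ := Nat.exists_eq_pow_mul_and_not_dvd (orderOf_pos x).ne' p hp.ne_one
  have hc : (p ^ k).Coprime m := Nat.Coprime.pow_left _ ((hp.coprime_iff_not_dvd).2 hm)
  obtain ⟨e, he1, he0⟩ := Nat.chineseRemainder hc 1 0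
  refine ⟨x ^ e, ⟨a, ?_⟩, ?_⟩
  · obtain ⟨c, rfl⟩ := Nat.modEq_zero_iff_dvd.1 he0
    rw [← pow_mul, show m * c * p ^ a = orderOf x * c by rw [hx]; ring, pow_mul,
      pow_orderOf_eq_one, one_pow]
  · rw [map_pow]
    have : e ≡ 1 [MOD orderOf (f x)] := he1.of_dvd (orderOf_dvd_of_pow_eq_one hk)
    simpa using pow_eq_pow_iff_modEq.2 this

theorem IsPElement.exists_mem_sylow {x : G} (h : IsPElement p x) : ∃ P : Sylow p G, x ∈ P :=
  h.isPGroup_zpowers.exists_le_sylow.imp fun _ hP => hP (Subgroup.mem_zpowers x)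

theorem exists_ne_one_pow_eq_one [Finite G] (hp : p.Prime) (h : p ∣ Nat.card G) :
    ∃ x : G, x ≠ 1 ∧ x ^ p = 1 := by
  have := Fact.mk hp
  obtain ⟨x, hx⟩ := exists_prime_orderOf_dvd_card' p h
  refine ⟨x, ?_, hx ▸ pow_orderOf_eq_one x⟩
  rintro rfl
  exact hp.ne_one (by simpa using hx.symm)

theorem isPiGroup_iff [Finite G] :
    IsPiGroup π G ↔ ∀ p : ℕ, p.Prime → p ∉ π → ∀ x : G, IsPElement p x → x = 1 := by
  refine ⟨fun h p hp hpπ x hx =>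
    hx.eq_one_of_not_dvd hp pow_card_eq_one' fun hd => hpπ (h p hp hd), fun h p hp hd => ?_⟩
  by_contra hpπ
  obtain ⟨x, hx1, hx⟩ := exists_ne_one_pow_eq_one hp hd
  exact hx1 (h p hp hpπ x ⟨1, by rwa [pow_one]⟩)

theorem isPiGroup_coe_iff [Finite G] {K : Subgroup G} :
    IsPiGroup π K ↔ ∀ p : ℕ, p.Prime → p ∉ π → ∀ x ∈ K, IsPElement p x → x = 1 := by
  simp only [isPiGroup_iff, Subtype.forall, ← isPElement_coe_iff, Subgroup.mk_eq_one]

theorem isPiNumber_relIndex [Finite G] {B C : Subgroup G}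
    (h : ∀ p : ℕ, p.Prime → p ∉ π → ∀ x ∈ B, IsPElement p x → x ∈ C) :
    IsPiNumber π (C.relIndex B) := by
  intro p hp hd
  by_contra hpπ
  have := Fact.mk hp
  obtain ⟨P⟩ : Nonempty (Sylow p B) := inferInstance
  have hPC : (P : Subgroup B) ≤ C.subgroupOf B := fun x hx =>
    h p hp hpπ x x.2 (isPElement_coe_iff.2 (isPElement_of_mem P.isPGroup' hx))
  exact P.not_dvd_index (hd.trans (Subgroup.index_dvd_of_le hPC))

theorem IsPElement.mem_of_isPiNumber_relIndex {B C : Subgroup G}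
    (hBC : B ≤ Subgroup.normalizer (C : Set G)) (h : IsPiNumber π (C.relIndex B))
    (hp : p.Prime) (hpπ : p ∉ π) {x : G} (hx : x ∈ B) (hxp : IsPElement p x) : x ∈ C := by
  have := Subgroup.normal_subgroupOf_of_le_normalizer hBC
  have hx1 : QuotientGroup.mk' (C.subgroupOf B) ⟨x, hx⟩ = 1 :=
    ((isPElement_coe_iff.1 hxp).map _).eq_one_of_not_dvd hp (n := C.relIndex B) pow_card_eq_one'
      fun hd => hpπ (h p hp hd)
  rwa [QuotientGroup.mk'_apply, QuotientGroup.eq_one_iff] at hx1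

theorem le_of_forall_isPElement_mem [Finite G] {K S : Subgroup G}
    (h : ∀ p : ℕ, p.Prime → ∀ x ∈ K, IsPElement p x → x ∈ S) : K ≤ S :=
  Subgroup.relIndex_eq_one.1 (isPiNumber_relIndex fun p hp _ => h p hp).eq_one

theorem IsPElement.mem_of_not_dvd_index [Finite G] {C : Subgroup G} [C.Normal] (hp : p.Prime)
    (h : ¬ p ∣ C.index) {x : G} (hx : IsPElement p x) : x ∈ C := by
  refine hx.mem_of_isPiNumber_relIndex (π := {p}ᶜ) (B := ⊤) Subgroup.le_normalizer_of_normal ?_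
    hp (by simp) (Subgroup.mem_top x)
  rw [Subgroup.relIndex_top_right]
  rintro q - hd rfl
  exact h hd

end Elements

section PiGenerated

variable {G : Type*} [Group G] {π ρ : Set ℕ} {K S : Subgroup G}

/-- The subgroup generated by the `p`-elements of `K` for all primes `p ∈ π`, usually written
`O^{π'}(K)`. -/
def piGenerated (π : Set ℕ) (K : Subgroup G) : Subgroup G :=
  Subgroup.closure {x | x ∈ K ∧ ∃ p : ℕ, p.Prime ∧ p ∈ π ∧ IsPElement p x}

theorem mem_piGenerated {p : ℕ} (hp : p.Prime) (hpπ : p ∈ π) {x : G} (hx : x ∈ K)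
    (hxp : IsPElement p x) : x ∈ piGenerated π K :=
  Subgroup.subset_closure ⟨hx, p, hp, hpπ, hxp⟩

theorem piGenerated_le
    (h : ∀ p : ℕ, p.Prime → p ∈ π → ∀ x ∈ K, IsPElement p x → x ∈ S) : piGenerated π K ≤ S :=
  (Subgroup.closure_le _).2 fun x ⟨hx, p, hp, hpπ, hxp⟩ => h p hp hpπ x hx hxp

theorem piGenerated_le_self : piGenerated π K ≤ K :=
  piGenerated_le fun _ _ _ _ hx _ => hx

theorem piGenerated_union :
    piGenerated (π ∪ ρ) K = piGenerated π K ⊔ piGenerated ρ K := by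
  rw [piGenerated, piGenerated, piGenerated, ← Subgroup.closure_union]
  congr 1
  ext x
  simp only [Set.mem_union, Set.mem_ofPred_eq, or_and_right, and_or_left, exists_or]

theorem IsPiGroup.le_piGenerated [Finite G] (h : IsPiGroup π K) (hKS : K ≤ S) :
    K ≤ piGenerated π S :=
  le_of_forall_isPElement_mem fun p hp x hx hxp => by
    by_cases hpπ : p ∈ π
    · exact mem_piGenerated hp hpπ (hKS hx) hxp
    · exact isPiGroup_coe_iff.1 h p hp hpπ x hx hxp ▸ Subgroup.one_mem _

theorem le_normalizer_piGenerated {B : Subgroup G} (h : B ≤ Subgroup.normalizer (K : Set G)) :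
    B ≤ Subgroup.normalizer (piGenerated π K : Set G) :=
  Subgroup.le_normalizer_closure_iff.2 fun b hb _ ⟨hx, p, hp, hpπ, hxp⟩ =>
    Subgroup.subset_closure ⟨Subgroup.le_normalizer_iff.1 h b hb _ hx, p, hp, hpπ, hxp.conj b⟩

instance piGenerated_normal [K.Normal] : (piGenerated π K).Normal :=
  Subgroup.normalizer_eq_top_iff.1 (top_le_iff.1
    (le_normalizer_piGenerated Subgroup.le_normalizer_of_normal))

/-- By Burnside's transfer theorem a central Sylow subgroup is a direct factor, and the projection
onto it kills all the generators. -/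
theorem not_dvd_card_of_sylow_le_center [Finite G] {q : ℕ} [Fact q.Prime] (Q : Sylow q G)
    (hQ : (Q : Subgroup G) ≤ Subgroup.center G) {s : Set G} (hs : Subgroup.closure s = ⊤)
    (h : ∀ x ∈ s, ∃ p : ℕ, p.Prime ∧ p ≠ q ∧ IsPElement p x) : ¬ q ∣ Nat.card G := by
  have hnc : Subgroup.normalizer (Q : Set G) ≤ Subgroup.centralizer (Q : Set G) :=
    fun x _ y hy => (Subgroup.mem_center_iff.1 (hQ hy) x).symm
  have hker : (MonoidHom.transferSylow Q hnc).ker = ⊤ := by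
    rw [← top_le_iff, ← hs, Subgroup.closure_le]
    intro x hx
    obtain ⟨p, hp, hpq, hxp⟩ := h x hx
    exact (hxp.map _).eq_one_of_ne hp Fact.out hpq (Q.isPGroup' _)
  have := MonoidHom.not_dvd_card_ker_transferSylow Q hnc
  rwa [hker, Subgroup.card_top] at this

theorem isPiGroup_piGenerated [Finite G]
    (h : ∀ p q : ℕ, p.Prime → q.Prime → p ∈ π → q ∉ π → ∀ x ∈ K, ∀ y ∈ K, IsPElement p x →
      IsPElement q y → Commute x y) : IsPiGroup π (piGenerated π K) := by
  intro q hq hd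
  by_contra hqπ
  have := Fact.mk hq
  obtain ⟨Q⟩ : Nonempty (Sylow q (piGenerated π K)) := inferInstance
  refine not_dvd_card_of_sylow_le_center Q (fun y hy => Subgroup.mem_center_iff.2 fun x => ?_)
    Subgroup.closure_closure_coe_preimage ?_ hd
  · have hyq : IsPElement q (y : G) :=
      isPElement_coe_iff.2 (isPElement_of_mem Q.isPGroup' hy)
    have hcen : piGenerated π K ≤ Subgroup.centralizer {(y : G)} :=
      piGenerated_le fun p hp hpπ z hz hzp => Subgroup.mem_centralizer_singleton_iff.2
        (h p q hp hq hpπ hqπ z hz y (piGenerated_le_self y.2) hzp hyq)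
    exact Subtype.ext (Subgroup.mem_centralizer_singleton_iff.1 (hcen x.2))
  · rintro x ⟨-, p, hp, hpπ, hxp⟩
    exact ⟨p, hp, fun hpq => hqπ (hpq ▸ hpπ), isPElement_coe_iff.1 hxp⟩

end PiGenerated

/-! ### The `σ`-nilpotent residual -/

section Separated

variable {I : Type v} {σ : I → Set ℕ} {p q : ℕ} {i j : I}

/-- The primes `p` and `q` lie in no common class of `σ`. -/
def AreSeparated (σ : I → Set ℕ) (p q : ℕ) : Prop :=
  p.Prime ∧ q.Prime ∧ ∀ i, p ∈ σ i → q ∉ σ i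

theorem AreSeparated.symm (h : AreSeparated σ p q) : AreSeparated σ q p :=
  ⟨h.2.1, h.1, fun i hq hp => h.2.2 i hp hq⟩

theorem exists_common_or_areSeparated (σ : I → Set ℕ) (hp : p.Prime) (hq : q.Prime) :
    (∃ i, p ∈ σ i ∧ q ∈ σ i) ∨ AreSeparated σ p q :=
  or_iff_not_imp_left.2 fun h => ⟨hp, hq, fun i hpi hqi => h ⟨i, hpi, hqi⟩⟩

theorem IsPrimePartition.exists_mem (hσ : IsPrimePartition σ) (hp : p.Prime) : ∃ i, p ∈ σ i :=
  Set.mem_iUnion.1 (hσ.1 ▸ hp)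

theorem IsPrimePartition.prime (hσ : IsPrimePartition σ) (hp : p ∈ σ i) : p.Prime := by
  have : p ∈ ⋃ i, σ i := Set.mem_iUnion.2 ⟨i, hp⟩
  rwa [hσ.1] at this

theorem IsPrimePartition.eq (hσ : IsPrimePartition σ) (hi : p ∈ σ i) (hj : p ∈ σ j) : i = j := by
  by_contra hij
  exact (hσ.2 i j hij).subset ⟨hi, hj⟩

theorem IsPrimePartition.areSeparated (hσ : IsPrimePartition σ) (hp : p ∈ σ i) (hq : q.Prime)
    (hqi : q ∉ σ i) : AreSeparated σ p q :=
  ⟨hσ.prime hp, hq, fun _ hj => hσ.eq hp hj ▸ hqi⟩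

theorem AreSeparated.ne (hσ : IsPrimePartition σ) (h : AreSeparated σ p q) : p ≠ q := by
  rintro rfl
  obtain ⟨i, hi⟩ := hσ.exists_mem h.1
  exact h.2.2 i hi hi

theorem IsPrimePartition.finite_memSigma (hσ : IsPrimePartition σ) (G : Type*) [Finite G]
    [Nonempty G] : {i | MemSigma σ G i}.Finite := by
  have hsub : {i | MemSigma σ G i} ⊆ ⋃ p ∈ (Nat.card G).primeFactors, {i | p ∈ σ i} := by
    rintro i ⟨p, hpi, hp⟩
    exact Set.mem_biUnion (Nat.mem_primeFactors.2 ⟨hσ.prime hpi, hp, Nat.card_pos.ne'⟩) hpi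
  have hclass : ∀ p, {i | p ∈ σ i}.Finite := fun p =>
    Set.Subsingleton.finite fun i hi j hj => hσ.eq hi hj
  exact ((Finset.finite_toSet _).biUnion fun p _ => hclass p).subset hsub

end Separated

section Residual

variable {I : Type v} {σ : I → Set ℕ} {G G' : Type*} [Group G] [Group G']

/-- The subgroup generated by the commutators of `p`-elements with `q`-elements, where `p` and `q`
lie in different classes of `σ`. For finite `G` it is the `σ`-nilpotent residual; see
`sigmaNilpotentResidual_eq`. -/
def sigmaCommutator (σ : I → Set ℕ) (G : Type*) [Group G] : Subgroup G :=
  Subgroup.closure {z | ∃ p q : ℕ, ∃ x y : G,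
    AreSeparated σ p q ∧ IsPElement p x ∧ IsPElement q y ∧ ⁅x, y⁆ = z}

theorem commutator_mem_sigmaCommutator {p q : ℕ} {x y : G} (h : AreSeparated σ p q)
    (hx : IsPElement p x) (hy : IsPElement q y) : ⁅x, y⁆ ∈ sigmaCommutator σ G :=
  Subgroup.subset_closure ⟨p, q, x, y, h, hx, hy, rfl⟩

theorem sigmaCommutator_le {S : Subgroup G}
    (h : ∀ p q : ℕ, AreSeparated σ p q → ∀ x y : G, IsPElement p x → IsPElement q y → ⁅x, y⁆ ∈ S) :
    sigmaCommutator σ G ≤ S := by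
  rw [sigmaCommutator, Subgroup.closure_le]
  rintro _ ⟨p, q, x, y, hpq, hx, hy, rfl⟩
  exact h p q hpq x y hx hy

theorem map_sigmaCommutator [Finite G] {f : G →* G'} (hf : Function.Surjective f) :
    (sigmaCommutator σ G).map f = sigmaCommutator σ G' := by
  apply le_antisymm
  · rw [Subgroup.map_le_iff_le_comap]
    refine sigmaCommutator_le fun p q hpq x y hx hy => ?_
    rw [Subgroup.mem_comap, map_commutatorElement]
    exact commutator_mem_sigmaCommutator hpq (hx.map f) (hy.map f)
  · refine sigmaCommutator_le fun p q hpq x y hx hy => ?_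
    obtain ⟨x, hx', rfl⟩ := hx.exists_lift hpq.1 hf
    obtain ⟨y, hy', rfl⟩ := hy.exists_lift hpq.2.1 hf
    rw [← map_commutatorElement]
    exact Subgroup.mem_map_of_mem f (commutator_mem_sigmaCommutator hpq hx' hy')

instance sigmaCommutator_normal : (sigmaCommutator σ G).Normal := by
  refine Subgroup.normalizer_eq_top_iff.1 (top_le_iff.1 (Subgroup.le_normalizer_closure_iff.2 ?_))
  rintro b - _ ⟨p, q, x, y, hpq, hx, hy, rfl⟩
  rw [conjugate_commutatorElement]
  exact commutator_mem_sigmaCommutator hpq (hx.conj b) (hy.conj b)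

theorem sigmaCommutator_eq_bot_iff : sigmaCommutator σ G = ⊥ ↔
    ∀ p q : ℕ, AreSeparated σ p q → ∀ x y : G, IsPElement p x → IsPElement q y → Commute x y := by
  refine ⟨fun h p q hpq x y hx hy => commutatorElement_eq_one_iff_commute.1 ?_, fun h => ?_⟩
  · exact Subgroup.mem_bot.1 (h ▸ commutator_mem_sigmaCommutator hpq hx hy)
  · exact eq_bot_iff.2 (sigmaCommutator_le fun p q hpq x y hx hy =>
      commutatorElement_eq_one_iff_commute.2 (h p q hpq x y hx hy))

theorem IsSigmaNilpotent.sigmaCommutator_eq_bot [Finite G] (h : IsSigmaNilpotent σ G) :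
    sigmaCommutator σ G = ⊥ := by
  obtain ⟨n, H, _, hH, ⟨e⟩⟩ := h
  have hfin : ∀ k, Finite (H k) := fun k =>
    Finite.of_surjective (fun g : G => e g k) fun y => ⟨e.symm (Pi.mulSingle k y), by simp⟩
  rw [sigmaCommutator_eq_bot_iff]
  intro p q hpq x y hx hy
  suffices Commute (e x) (e y) from e.injective (by simpa using this.eq)
  refine funext fun k => ?_
  obtain ⟨i, hi⟩ := hH k
  rw [isPiGroup_iff] at hi
  have hxk : IsPElement p (e x k) := hx.map ((Pi.evalMonoidHom H k).comp e.toMonoidHom)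
  have hyk : IsPElement q (e y k) := hy.map ((Pi.evalMonoidHom H k).comp e.toMonoidHom)
  by_cases hpi : p ∈ σ i
  · simp [hi q hpq.2.1 (hpq.2.2 i hpi) _ hyk]
  · simp [hi p hpq.1 hpi _ hxk]

theorem isSigmaNilpotent_of_iSup_eq_top {G : Type u} [Group G] {ι : Type*} [Finite ι]
    {H : ι → Subgroup G} (hH : ∀ k, IsSigmaPrimary σ (H k))
    (hcomm : Pairwise fun k l => ∀ x y : G, x ∈ H k → y ∈ H l → Commute x y)
    (hind : iSupIndep H) (htop : ⨆ k, H k = ⊤) : IsSigmaNilpotent σ G := by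
  let e := (Finite.equivFin ι).symm
  have hcomm' : Pairwise fun k l => ∀ x y : G, x ∈ H (e k) → y ∈ H (e l) → Commute x y :=
    hcomm.comp_of_injective e.injective
  refine ⟨_, fun k => H (e k), inferInstance, fun k => hH _, ⟨(MulEquiv.ofBijective
    (Subgroup.noncommPiCoprod hcomm') ⟨Subgroup.injective_noncommPiCoprod_of_iSupIndep
      (hind.comp e.injective), ?_⟩).symm⟩⟩
  rw [← MonoidHom.range_eq_top, Subgroup.noncommPiCoprod_range, ← htop]
  exact e.surjective.iSup_comp H

theorem commute_of_mem_piGenerated {π ρ : Set ℕ} {K L : Subgroup G}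
    (h : ∀ p q : ℕ, p.Prime → q.Prime → p ∈ π → q ∈ ρ → ∀ x ∈ K, ∀ y ∈ L, IsPElement p x →
      IsPElement q y → Commute x y) {x y : G} (hx : x ∈ piGenerated π K)
    (hy : y ∈ piGenerated ρ L) : Commute x y := by
  have hle : piGenerated π K ≤ Subgroup.centralizer {y} := by
    refine piGenerated_le fun p hp hpπ z hz hzp => ?_
    have : piGenerated ρ L ≤ Subgroup.centralizer {z} := piGenerated_le fun q hq hqρ w hw hwq =>
      Subgroup.mem_centralizer_singleton_iff.2 (h p q hp hq hpπ hqρ z hz w hw hzp hwq).symm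
    exact Subgroup.mem_centralizer_singleton_iff.2
      (Subgroup.mem_centralizer_singleton_iff.1 (this hy)).symm
  exact Subgroup.mem_centralizer_singleton_iff.1 (hle hx)

theorem commute_of_forall_isPElement [Finite G] {K L : Subgroup G}
    (h : ∀ p q : ℕ, p.Prime → q.Prime → ∀ x ∈ K, ∀ y ∈ L, IsPElement p x → IsPElement q y →
      Commute x y) {x y : G} (hx : x ∈ K) (hy : y ∈ L) : Commute x y := by
  have hle (J : Subgroup G) : J ≤ piGenerated Set.univ J :=
    IsPiGroup.le_piGenerated (fun _ _ _ => Set.mem_univ _) le_rfl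
  exact commute_of_mem_piGenerated (fun p q hp hq _ _ => h p q hp hq) (hle K hx) (hle L hy)

theorem iSup_piGenerated_eq_top [Finite G] (hσ : IsPrimePartition σ) :
    ⨆ i : {i // MemSigma σ G i}, piGenerated (σ i) (⊤ : Subgroup G) = ⊤ := by
  refine top_le_iff.1 (le_of_forall_isPElement_mem fun p hp x hx hxp => ?_)
  by_cases hd : p ∣ Nat.card G
  · obtain ⟨i, hi⟩ := hσ.exists_mem hp
    have hle := le_iSup (fun i : {i // MemSigma σ G i} => piGenerated (σ i) (⊤ : Subgroup G))
      ⟨i, p, hi, hd⟩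
    exact hle (mem_piGenerated hp hi hx hxp)
  · exact hxp.eq_one_of_not_dvd hp pow_card_eq_one' hd ▸ Subgroup.one_mem _

theorem isPiGroup_piGenerated_of_sigmaCommutator_eq_bot [Finite G] (hσ : IsPrimePartition σ)
    (h : sigmaCommutator σ G = ⊥) (i : I) (K : Subgroup G) :
    IsPiGroup (σ i) (piGenerated (σ i) K) :=
  isPiGroup_piGenerated fun p q _ hq hpi hqi x _ y _ hx hy =>
    sigmaCommutator_eq_bot_iff.1 h p q (hσ.areSeparated hpi hq hqi) x y hx hy

theorem isSigmaNilpotent_of_sigmaCommutator_eq_bot {G : Type u} [Group G] [Finite G]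
    (hσ : IsPrimePartition σ) (h : sigmaCommutator σ G = ⊥) : IsSigmaNilpotent σ G := by
  let H : {i // MemSigma σ G i} → Subgroup G := fun i => piGenerated (σ i) ⊤
  have hfin : Finite {i // MemSigma σ G i} := (hσ.finite_memSigma G).to_subtype
  have := Fintype.ofFinite {i // MemSigma σ G i}
  have hpi (i : {i // MemSigma σ G i}) : IsPiGroup (σ i) (H i) :=
    isPiGroup_piGenerated_of_sigmaCommutator_eq_bot hσ h i ⊤
  have hcomm : Pairwise fun i j => ∀ x y : G, x ∈ H i → y ∈ H j → Commute x y :=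
    fun i j hij x y => commute_of_mem_piGenerated fun p q _ hq hpi hqj x _ y _ hx hy =>
      sigmaCommutator_eq_bot_iff.1 h p q
        (hσ.areSeparated hpi hq fun hqi => hij (Subtype.ext (hσ.eq hqi hqj))) x y hx hy
  have hcop : Pairwise fun i j => (Nat.card (H i)).Coprime (Nat.card (H j)) := fun i j hij =>
    IsPiNumber.coprime (hpi i) fun p hp hpj hmem =>
      hij (Subtype.ext (hσ.eq hmem (hpi j p hp hpj)))
  have (i : {i // MemSigma σ G i}) : Fintype (H i) := Fintype.ofFinite _
  have hind : iSupIndep H := Subgroup.independent_of_coprime_order hcomm fun i j hij => by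
    simpa only [Nat.card_eq_fintype_card] using hcop hij
  exact isSigmaNilpotent_of_iSup_eq_top (fun i => ⟨_, hpi i⟩) hcomm hind
    (iSup_piGenerated_eq_top hσ)

theorem isSigmaNilpotent_iff {G : Type u} [Group G] [Finite G] (hσ : IsPrimePartition σ) :
    IsSigmaNilpotent σ G ↔ sigmaCommutator σ G = ⊥ :=
  ⟨fun h => h.sigmaCommutator_eq_bot, isSigmaNilpotent_of_sigmaCommutator_eq_bot hσ⟩

theorem sigmaCommutator_quotient_eq_bot_iff [Finite G] {N : Subgroup G} [N.Normal] :
    sigmaCommutator σ (G ⧸ N) = ⊥ ↔ sigmaCommutator σ G ≤ N := by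
  rw [← map_sigmaCommutator (QuotientGroup.mk'_surjective N), Subgroup.map_eq_bot_iff,
    QuotientGroup.ker_mk']

theorem sigmaNilpotentResidual_eq {G : Type u} [Group G] [Finite G] (hσ : IsPrimePartition σ) :
    sigmaNilpotentResidual σ G = sigmaCommutator σ G := by
  apply le_antisymm
  · exact sInf_le ⟨inferInstance,
      (isSigmaNilpotent_iff hσ).2 (sigmaCommutator_quotient_eq_bot_iff.2 le_rfl)⟩
  · refine le_sInf ?_
    rintro N ⟨hN, h⟩
    exact sigmaCommutator_quotient_eq_bot_iff.1 h.sigmaCommutator_eq_bot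

theorem isPiNumber_relIndex_piGenerated_sup [Finite G] (hσ : IsPrimePartition σ) (i : I) :
    IsPiNumber (σ i) ((sigmaCommutator σ G).relIndex
      (piGenerated (σ i) (⊤ : Subgroup G) ⊔ sigmaCommutator σ G)) := by
  let f := QuotientGroup.mk' (sigmaCommutator σ G)
  have hmap : (piGenerated (σ i) (⊤ : Subgroup G)).map f ≤ piGenerated (σ i) ⊤ :=
    Subgroup.map_le_iff_le_comap.2 (piGenerated_le fun p hp hpi x _ hx =>
      mem_piGenerated hp hpi (Subgroup.mem_top _) (hx.map f))
  have hrel : (sigmaCommutator σ G).relIndex (piGenerated (σ i) (⊤ : Subgroup G)) =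
      Nat.card ((piGenerated (σ i) (⊤ : Subgroup G)).map f) := by
    rw [← Subgroup.relIndex_ker, QuotientGroup.ker_mk']
  rw [Subgroup.relIndex_sup_right, hrel]
  exact IsPiNumber.of_dvd (isPiGroup_piGenerated_of_sigmaCommutator_eq_bot hσ
    (sigmaCommutator_quotient_eq_bot_iff.2 le_rfl) i ⊤) (Subgroup.card_dvd_of_le hmap)

end Residual

/-! ### Hall subgroups of `σ`-soluble groups -/

section Soluble

variable {I : Type v} {σ : I → Set ℕ} {G G' : Type*} [Group G] [Group G']

/-- Every proper normal subgroup `L` of `G` lies below a strictly larger normal subgroup `N` whose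
quotient `N / L` is `σ`-primary. This is the consequence of `σ`-solubility that passes to
subgroups without effort. -/
def HasSigmaSeries (σ : I → Set ℕ) (G : Type*) [Group G] : Prop :=
  ∀ L : Subgroup G, L.Normal → L ≠ ⊤ →
    ∃ N : Subgroup G, N.Normal ∧ L < N ∧ ∃ i, IsPiNumber (σ i) (L.relIndex N)

theorem IsSigmaSoluble.exists_minimal_normal [Finite G] (h : IsSigmaSoluble σ G)
    {L T : Subgroup G} (hL : L.Normal) (hT : T.Normal) (hLT : L < T) :
    ∃ N ≤ T, Minimal (fun M : Subgroup G => M.Normal ∧ L < M) N ∧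
      ∃ i, IsPiNumber (σ i) (L.relIndex N) := by
  obtain ⟨N, hNT, hN⟩ :=
    Finite.exists_le_minimal (p := fun M : Subgroup G => M.Normal ∧ L < M) ⟨hT, hLT⟩
  refine ⟨N, hNT, hN, h N L ⟨hN.prop.1, hL, hN.prop.2, fun M hM hLM hMN => ?_⟩⟩
  exact hLM.eq_or_lt.imp Eq.symm fun hLM => hN.eq_of_le ⟨hM, hLM⟩ hMN

theorem IsSigmaSoluble.hasSigmaSeries [Finite G] (h : IsSigmaSoluble σ G) :
    HasSigmaSeries σ G := by
  intro L hL hne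
  obtain ⟨N, -, hN, hi⟩ := h.exists_minimal_normal hL inferInstance hne.lt_top
  exact ⟨N, hN.prop.1, hN.prop.2, hi⟩

theorem IsChiefFactor.comap {H K : Subgroup G'} (h : IsChiefFactor H K) {f : G →* G'}
    (hf : Function.Surjective f) : IsChiefFactor (H.comap f) (K.comap f) := by
  obtain ⟨hH, hK, hKH, hmin⟩ := h
  refine ⟨hH.comap f, hK.comap f, (Subgroup.comap_lt_comap_of_surjective hf).2 hKH,
    fun N hN hKN hNH => ?_⟩
  obtain ⟨N, rfl⟩ : ∃ N' : Subgroup G', N'.comap f = N :=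
    ⟨N.map f, Subgroup.comap_map_eq_self ((Subgroup.ker_le_comap f K).trans hKN)⟩
  have hN' : N.Normal := Subgroup.map_comap_eq_self_of_surjective hf N ▸ hN.map f hf
  exact (hmin N hN' ((Subgroup.comap_le_comap_of_surjective hf).1 hKN)
    ((Subgroup.comap_le_comap_of_surjective hf).1 hNH)).imp (congrArg _) (congrArg _)

theorem relIndex_comap_comap {f : G →* G'} (hf : Function.Surjective f) (H K : Subgroup G') :
    (K.comap f).relIndex (H.comap f) = K.relIndex H := by
  rw [Subgroup.relIndex_comap, Subgroup.map_comap_eq_self_of_surjective hf]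

theorem IsSigmaSoluble.of_surjective (h : IsSigmaSoluble σ G) {f : G →* G'}
    (hf : Function.Surjective f) : IsSigmaSoluble σ G' := by
  intro H K hHK
  obtain ⟨i, hi⟩ := h _ _ (hHK.comap hf)
  exact ⟨i, fun p hp hd => hi p hp (hd.trans (relIndex_comap_comap hf H K).symm.dvd)⟩

theorem HasSigmaSeries.subgroup [Finite G] (h : HasSigmaSeries σ G) (K : Subgroup G) :
    HasSigmaSeries σ K := by
  intro L hL hne
  obtain ⟨N, -, ⟨hN, hNL⟩, hmax⟩ := Finite.exists_le_maximal
    (p := fun N : Subgroup G => N.Normal ∧ N.subgroupOf K ≤ L) (a := ⊥) ⟨inferInstance, by simp⟩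
  have hNt : N ≠ ⊤ := by
    rintro rfl
    exact hne (top_le_iff.1 (by simpa using hNL))
  obtain ⟨N', hN', hlt, i, hi⟩ := h N hN hNt
  refine ⟨L ⊔ N'.subgroupOf K, inferInstance, left_lt_sup.2 fun hle => ?_, i, ?_⟩
  · exact hlt.not_ge (hmax ⟨hN', hle⟩ hlt.le)
  · rw [Subgroup.relIndex_sup_left]
    refine isPiNumber_relIndex fun p hp hpi x hx hxp => hNL (Subgroup.mem_subgroupOf.2 ?_)
    exact (isPElement_coe_iff.2 hxp).mem_of_isPiNumber_relIndex
      Subgroup.le_normalizer_of_normal hi hp hpi (Subgroup.mem_subgroupOf.1 hx)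

/-- The Schur–Zassenhaus theorem for `N / L` in `G / L`. -/
theorem exists_relative_complement {L N : Subgroup G} [L.Normal] [N.Normal]
    (hLN : L ≤ N) (hc : (L.relIndex N).Coprime N.index) :
    ∃ S : Subgroup G, L ≤ S ∧ L.relIndex S = N.index ∧ S.index = L.relIndex N := by
  let f := QuotientGroup.mk' L
  have hf : Function.Surjective f := QuotientGroup.mk'_surjective L
  have hker : f.ker = L := QuotientGroup.ker_mk' L
  have hcard (K : Subgroup G) : Nat.card (K.map f) = L.relIndex K := by
    rw [← Subgroup.relIndex_ker, hker]
  have hidx : (N.map f).index = N.index := Subgroup.index_map_eq N hf (hker.trans_le hLN)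
  have hN : (N.map f).Normal := Subgroup.Normal.map inferInstance f hf
  obtain ⟨S, hS⟩ := Subgroup.exists_right_complement'_of_coprime (N := N.map f)
    (by rwa [hcard, hidx])
  refine ⟨S.comap f, hker.ge.trans (Subgroup.ker_le_comap f S), ?_, ?_⟩
  · rw [← hcard, Subgroup.map_comap_eq_self_of_surjective hf, ← hS.symm.index_eq_card, hidx]
  · rw [Subgroup.index_comap_of_surjective _ hf, hS.index_eq_card, hcard]

theorem exists_relative_complement_of_le [Finite G] {L N T : Subgroup G} [L.Normal] [N.Normal]
    (hLN : L ≤ N) (hNT : N ≤ T) (hc : (L.relIndex N).Coprime (N.relIndex T)) :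
    ∃ S ≤ T, L ≤ S ∧ L.relIndex S = N.relIndex T ∧ S.relIndex T = L.relIndex N := by
  have hLNT : (L.subgroupOf T).relIndex (N.subgroupOf T) = L.relIndex N :=
    Subgroup.relIndex_subgroupOf hNT
  obtain ⟨S, hLS, hS, hST⟩ := exists_relative_complement (L := L.subgroupOf T)
    (N := N.subgroupOf T) (Subgroup.comap_mono hLN) (hLNT ▸ hc)
  refine ⟨S.map T.subtype, Subgroup.map_subtype_le S, ?_, ?_, ?_⟩
  · rw [← Subgroup.map_subgroupOf_eq_of_le (hLN.trans hNT)]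
    exact Subgroup.map_mono hLS
  · rw [← Subgroup.relIndex_comap]
    exact hS
  · rw [← hLNT, ← hST, Subgroup.relIndex, Subgroup.subgroupOf,
      Subgroup.comap_map_eq_self_of_injective T.subtype_injective]

theorem HasSigmaSeries.exists_isHallPi [Finite G] (hσ : IsPrimePartition σ)
    (h : HasSigmaSeries σ G) (i : I) : ∃ H : Subgroup G, IsHallPi (σ i) H := by
  suffices key : ∀ L : Subgroup G, L.Normal → ∃ T : Subgroup G, L ≤ T ∧
      IsPiNumber (σ i) (L.relIndex T) ∧ ∀ p : ℕ, p.Prime → p ∣ T.index → p ∉ σ i by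
    obtain ⟨T, -, hT, hidx⟩ := key ⊥ inferInstance
    rw [Subgroup.relIndex_bot_left] at hT
    exact ⟨T, hT, hidx⟩
  intro L
  induction L using WellFoundedGT.induction with
  | ind L ih =>
  intro hL
  by_cases hLt : L = ⊤
  · subst hLt
    refine ⟨⊤, le_rfl, fun p hp hd => ?_, fun p hp hd => ?_⟩
    · exact absurd (Subgroup.relIndex_self (⊤ : Subgroup G) ▸ hd) hp.not_dvd_one
    · exact absurd (Subgroup.index_top (G := G) ▸ hd) hp.not_dvd_one
  obtain ⟨N, hN, hLN, j, hj⟩ := h L hL hLt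
  obtain ⟨T, hNT, hT, hidx⟩ := ih N hLN hN
  by_cases hij : j = i
  · subst hij
    refine ⟨T, hLN.le.trans hNT, ?_, hidx⟩
    rw [← Subgroup.relIndex_mul_relIndex _ _ _ hLN.le hNT]
    exact hj.mul hT
  · have hLNi : ∀ p : ℕ, p.Prime → p ∣ L.relIndex N → p ∉ σ i := fun p hp hd hpi =>
      hij (hσ.eq (hj p hp hd) hpi)
    obtain ⟨S, hST, hLS, hS, hSidx⟩ :=
      exists_relative_complement_of_le hLN.le hNT (hT.coprime hLNi).symm
    refine ⟨S, hLS, hS ▸ hT, fun p hp hd => ?_⟩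
    rw [← Subgroup.relIndex_mul_index hST, hSidx, hp.dvd_mul] at hd
    exact hd.elim (hLNi p hp) (hidx p hp)

theorem HasSigmaSeries.isSigmaFull [Finite G] (hσ : IsPrimePartition σ)
    (h : HasSigmaSeries σ G) : IsSigmaFull σ G := fun i _ => h.exists_isHallPi hσ i

end Soluble

section Hall

variable {I : Type v} {σ : I → Set ℕ} {G : Type*} [Group G] {π : Set ℕ} {H : Subgroup G}

theorem IsHallPi.conj (h : IsHallPi π H) (g : G) :
    IsHallPi π (H.map (MulAut.conj g).toMonoidHom) := by
  refine ⟨fun p hp hd => h.1 p hp ?_, fun p hp hd => h.2 p hp ?_⟩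
  · rwa [Subgroup.card_map_of_injective (MulAut.conj g).injective] at hd
  · exact hd.trans (Subgroup.index_map_equiv H (MulAut.conj g)).dvd

theorem IsHallPi.exists_conj_mem [Finite G] (h : IsHallPi π H) {p : ℕ} (hp : p.Prime)
    (hpπ : p ∈ π) {x : G} (hx : IsPElement p x) : ∃ g : G, g⁻¹ * x * g ∈ H := by
  have := Fact.mk hp
  obtain ⟨Q⟩ : Nonempty (Sylow p H) := inferInstance
  have hQ : ¬ p ∣ ((Q : Subgroup H).map H.subtype).index := by
    rw [Subgroup.index_map_subtype, hp.dvd_mul]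
    exact fun hd => hd.elim Q.not_dvd_index fun hd => h.2 p hp hd hpπ
  obtain ⟨P, hxP⟩ := hx.exists_mem_sylow
  obtain ⟨g, rfl⟩ := MulAction.exists_smul_eq G ((Q.isPGroup'.map H.subtype).toSylow hQ) P
  have hxP' := Subgroup.mem_pointwise_smul_iff_inv_smul_mem.1 hxP
  rw [IsPGroup.toSylow_coe, ← map_inv, MulAut.smul_def, MulAut.conj_apply, inv_inv] at hxP'
  exact ⟨g, Subgroup.map_subtype_le _ hxP'⟩

theorem IsHallPi.exists_mem [Finite G] (h : IsHallPi π H) {p : ℕ} (hp : p.Prime) (hpπ : p ∈ π)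
    {x : G} (hx : IsPElement p x) : ∃ K : Subgroup G, IsHallPi π K ∧ x ∈ K := by
  obtain ⟨g, hg⟩ := h.exists_conj_mem hp hpπ hx
  exact ⟨_, h.conj g, ⟨_, hg, by simp [mul_assoc]⟩⟩

theorem IsHallPi.eq_bot {i : I} (h : IsHallPi (σ i) H) (hi : ¬ MemSigma σ G i) :
    H = ⊥ := by
  rw [← Subgroup.card_eq_one]
  by_contra hne
  obtain ⟨p, hp, hd⟩ := Nat.exists_prime_and_dvd hne
  exact hi ⟨p, h.1 p hp hd, hd.trans H.card_subgroup_dvd_card⟩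

end Hall

/-! ### Permutability with Hall subgroups -/

section Permutes

variable {I : Type v} {σ : I → Set ℕ} {G : Type*} [Group G] {A B H : Subgroup G}

theorem Permutes.symm (h : Permutes A B) : Permutes B A := Eq.symm h

theorem permutes_of_le_normalizer (h : B ≤ Subgroup.normalizer (A : Set G)) : Permutes A B :=
  (Subgroup.set_mul_normalizer_comm _ _ h).symm

theorem permutes_of_normal [A.Normal] : Permutes A B :=
  permutes_of_le_normalizer Subgroup.le_normalizer_of_normal

theorem permutes_of_le (h : A ≤ B) : Permutes A B :=
  (permutes_of_le_normalizer (h.trans Subgroup.le_normalizer)).symm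

theorem permutes_of_subset (h : (B : Set G) * A ⊆ A * B) : Permutes A B := by
  refine Set.Subset.antisymm ?_ h
  simpa only [mul_inv_rev, inv_coe_set] using Set.inv_subset_inv.2 h

theorem Permutes.coe_sup (h : Permutes A B) : ((A ⊔ B : Subgroup G) : Set G) = A * B := by
  have hmul : (A * B : Set G) * (A * B) = A * B := by
    rw [mul_assoc, ← mul_assoc (B : Set G), ← h, mul_assoc, coe_mul_coe, ← mul_assoc, coe_mul_coe]
  have hinv : (A * B : Set G)⁻¹ = A * B := by
    rw [mul_inv_rev, inv_coe_set, inv_coe_set, h]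
  let S : Subgroup G :=
    { carrier := A * B
      one_mem' := ⟨1, A.one_mem, 1, B.one_mem, one_mul 1⟩
      mul_mem' := fun hx hy => hmul ▸ Set.mul_mem_mul hx hy
      inv_mem' := fun {x} hx => Set.mem_inv.1 (hinv.symm ▸ hx) }
  rw [Subgroup.sup_eq_closure_mul]
  exact congrArg _ (Subgroup.closure_eq S)

/-- The set `H (A ⊔ B)` is invariant under left multiplication by `A` and by `B`, hence by
`A ⊔ B`. -/
theorem Permutes.sup_left (hA : Permutes A H) (hB : Permutes B H) : Permutes (A ⊔ B) H := by
  let Z : Set G := H * (A ⊔ B : Subgroup G)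
  have hZ : ∀ C ≤ A ⊔ B, Permutes C H → C ≤ MulAction.stabilizer G Z := by
    intro C hC hCH c hc
    have hCS : (C : Set G) * (A ⊔ B : Subgroup G) = (A ⊔ B : Subgroup G) :=
      ((Set.mul_subset_mul_right hC).trans (coe_mul_coe _).subset).antisymm
        (Set.subset_mul_right _ C.one_mem)
    have hCZ : (C : Set G) * Z = Z := by rw [← mul_assoc, hCH, mul_assoc, hCS]
    rw [MulAction.mem_stabilizer_iff, ← hCZ, ← smul_mul_assoc, smul_coe_set hc]
  have hle : A ⊔ B ≤ MulAction.stabilizer G Z :=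
    sup_le (hZ A le_sup_left hA) (hZ B le_sup_right hB)
  refine (permutes_of_subset ?_).symm
  rintro _ ⟨x, hx, h, hh, rfl⟩
  have hhZ : h ∈ Z := ⟨h, hh, 1, Subgroup.one_mem _, mul_one h⟩
  have := Set.smul_mem_smul_set (a := x) hhZ
  rwa [MulAction.mem_stabilizer_iff.1 (hle hx)] at this

theorem relIndex_eq_of_subset_mul {X Y : Subgroup G} (hY : Y ≤ X) (h : (X : Set G) ⊆ Y * A) :
    A.relIndex Y = A.relIndex X := by
  let e := Subgroup.quotientSubgroupOfEmbeddingOfLE A hY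
  refine Nat.card_congr (Equiv.ofBijective e ⟨e.injective, fun q => ?_⟩)
  obtain ⟨⟨x, hx⟩, rfl⟩ := QuotientGroup.mk_surjective q
  obtain ⟨y, hy, a, ha, rfl⟩ := h hx
  exact ⟨QuotientGroup.mk ⟨y, hy⟩,
    QuotientGroup.eq.2 (Subgroup.mem_subgroupOf.2 (by simpa using ha))⟩

theorem Permutes.inf_le (hσ : IsPrimePartition σ) {N : Subgroup G} {i j : I}
    (hij : i ≠ j) (hAH : Permutes A H) (hAN : A ≤ N) (hH : IsPiGroup (σ j) H)
    (hi : IsPiNumber (σ i) (A.relIndex N)) : H ⊓ N ≤ A := by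
  have hHN : A.relIndex (H ⊓ N) = A.relIndex ((A ⊔ H) ⊓ N) := by
    refine relIndex_eq_of_subset_mul (inf_le_inf_right N le_sup_right) ?_
    rintro x ⟨hx, hxN⟩
    obtain ⟨h, hh, a, ha, rfl⟩ : x ∈ (H : Set G) * A := hAH ▸ hAH.coe_sup.subset hx
    exact ⟨h, ⟨hh, (N.mul_mem_cancel_right (hAN ha)).1 hxN⟩, a, ha, rfl⟩
  rw [← Subgroup.relIndex_eq_one]
  by_contra hne
  obtain ⟨p, hp, hd⟩ := Nat.exists_prime_and_dvd hne
  refine hij (hσ.eq (hi p hp ?_) (hH p hp ?_))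
  · exact (hd.trans hHN.dvd).trans (Dvd.intro _ (Subgroup.relIndex_mul_relIndex A ((A ⊔ H) ⊓ N) N
      (le_inf le_sup_left hAN) inf_le_right))
  · exact hd.trans ((Subgroup.relIndex_dvd_card _ _).trans (Subgroup.card_dvd_of_le inf_le_left))

/-- `A` permutes with every Hall `σ i`-subgroup of `G`, for every `i`. In a finite `σ`-full group
this is `σ`-permutability: normal subgroups permute with everything, and Hall `σ i`-subgroups with
`σ i ∉ σ(G)` are trivial. -/
def PermutesHalls (σ : I → Set ℕ) (A : Subgroup G) : Prop :=
  ∀ i, ∀ H : Subgroup G, IsHallPi (σ i) H → Permutes A H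

theorem IsSigmaPermutable.permutesHalls [Finite G] (h : IsSigmaPermutable σ A) :
    PermutesHalls σ A := by
  intro i H hH
  rcases h with hA | ⟨-, h⟩
  · exact permutes_of_normal
  by_cases hi : MemSigma σ G i
  · exact h i hi H hH
  · exact hH.eq_bot hi ▸ (permutes_of_le bot_le).symm

theorem PermutesHalls.isSigmaPermutable (h : PermutesHalls σ A) (hG : IsSigmaFull σ G) :
    IsSigmaPermutable σ A :=
  Or.inr ⟨hG, fun i _ H hH => h i H hH⟩

end Permutes

section Subnormal

variable {I : Type v} {σ : I → Set ℕ} {G G' : Type*} [Group G] [Group G'] {A B : Subgroup G}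

theorem sigmaSubnormalStep_iff : SigmaSubnormalStep σ A B ↔
    A ≤ B ∧ (B ≤ Subgroup.normalizer (A : Set G) ∨ ∃ i, ∃ C ≤ A,
      B ≤ Subgroup.normalizer (C : Set G) ∧ IsPiNumber (σ i) (C.relIndex B)) := by
  refine and_congr_right fun hAB => or_congr (Subgroup.normal_subgroupOf_iff_le_normalizer hAB)
    (exists_congr fun i => ⟨fun hi => ?_, ?_⟩)
  · let N := (A.subgroupOf B).normalCore
    have hN : (N.map B.subtype).subgroupOf B = N :=
      Subgroup.comap_map_eq_self_of_injective B.subtype_injective _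
    refine ⟨N.map B.subtype, ?_, ?_, ?_⟩
    · exact Subgroup.map_le_iff_le_comap.2 (Subgroup.normalCore_le _)
    · rw [← Subgroup.normal_subgroupOf_iff_le_normalizer (Subgroup.map_subtype_le _), hN]
      infer_instance
    · rw [Subgroup.relIndex, hN]
      exact hi
  · rintro ⟨C, hCA, hBC, hi⟩
    have hC := Subgroup.normal_subgroupOf_of_le_normalizer hBC
    exact hi.of_dvd
      (Subgroup.index_dvd_of_le (Subgroup.normal_le_normalCore.2 (Subgroup.comap_mono hCA)))

theorem relIndex_map_dvd (f : G →* G') (A B : Subgroup G) :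
    (A.map f).relIndex (B.map f) ∣ A.relIndex B := by
  rw [← Subgroup.relIndex_comap]
  exact Subgroup.relIndex_dvd_of_le_left B (Subgroup.le_comap_map f A)

theorem SigmaSubnormalStep.map
    (h : SigmaSubnormalStep σ A B) (f : G →* G') : SigmaSubnormalStep σ (A.map f) (B.map f) := by
  rw [sigmaSubnormalStep_iff] at h ⊢
  have hn (C : Subgroup G) (hC : B ≤ Subgroup.normalizer (C : Set G)) :
      B.map f ≤ Subgroup.normalizer (C.map f : Set G') :=
    (Subgroup.map_mono hC).trans (Subgroup.le_normalizer_map f)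
  refine ⟨Subgroup.map_mono h.1, h.2.imp (hn A) ?_⟩
  rintro ⟨i, C, hCA, hBC, hi⟩
  exact ⟨i, C.map f, Subgroup.map_mono hCA, hn C hBC, hi.of_dvd (relIndex_map_dvd f C B)⟩

theorem reflTransGen_sigmaSubnormalStep_map
    (h : Relation.ReflTransGen (SigmaSubnormalStep σ) A B) (f : G →* G') :
    Relation.ReflTransGen (SigmaSubnormalStep σ) (A.map f) (B.map f) :=
  Relation.ReflTransGen.lift (Subgroup.map f) (fun _ _ h => h.map f) _ _ h

theorem IsSigmaSubnormal.map_of_surjective (h : IsSigmaSubnormal σ A)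
    {f : G →* G'} (hf : Function.Surjective f) : IsSigmaSubnormal σ (A.map f) := by
  have := reflTransGen_sigmaSubnormalStep_map h f
  rwa [Subgroup.map_top_of_surjective f hf] at this

theorem IsSigmaSubnormal.map_subtype {K : Subgroup G} {H : Subgroup K}
    (h : IsSigmaSubnormal σ H) (hK : IsSigmaSubnormal σ K) :
    IsSigmaSubnormal σ (H.map K.subtype) := by
  have := reflTransGen_sigmaSubnormalStep_map h K.subtype
  rw [← MonoidHom.range_eq_map, K.range_subtype] at this
  exact this.trans hK

theorem IsSigmaSubnormal.of_le_normalizer (hB : IsSigmaSubnormal σ B)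
    (hAB : A ≤ B) (h : B ≤ Subgroup.normalizer (A : Set G)) : IsSigmaSubnormal σ A :=
  Relation.ReflTransGen.head (sigmaSubnormalStep_iff.2 ⟨hAB, Or.inl h⟩) hB

theorem isSigmaSubnormal_of_normal [A.Normal] : IsSigmaSubnormal σ A :=
  IsSigmaSubnormal.of_le_normalizer Relation.ReflTransGen.refl le_top
    Subgroup.le_normalizer_of_normal

/-- The subgroup of `B` generated by the elements of prime power order prime to `σ i` is normal of
`σ i`-index, and lies in `A` because the Hall `σ j`-subgroups with `j ≠ i` meet `B` inside `A`. -/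
theorem PermutesHalls.sigmaSubnormalStep [Finite G] (hσ : IsPrimePartition σ)
    (hG : HasSigmaSeries σ G) (hA : PermutesHalls σ A) (hAB : A ≤ B) {i : I}
    (hi : IsPiNumber (σ i) (A.relIndex B)) : SigmaSubnormalStep σ A B := by
  rw [sigmaSubnormalStep_iff]
  refine ⟨hAB, Or.inr ⟨i, piGenerated (σ i)ᶜ B, piGenerated_le fun p hp hpi x hx hxp => ?_,
    le_normalizer_piGenerated Subgroup.le_normalizer,
    isPiNumber_relIndex fun p hp hpi x hx hxp => mem_piGenerated hp hpi hx hxp⟩⟩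
  obtain ⟨j, hj⟩ := hσ.exists_mem hp
  obtain ⟨H, hH⟩ := hG.exists_isHallPi hσ j
  obtain ⟨K, hK, hxK⟩ := hH.exists_mem hp hj hxp
  have hij : i ≠ j := fun hij => hpi (hij ▸ hj)
  exact (hA j K hK).inf_le hσ hij hAB hK.1 hi ⟨hxK, hx⟩

theorem PermutesHalls.isSigmaSubnormal [Finite G] (hσ : IsPrimePartition σ)
    (hG : HasSigmaSeries σ G) (hA : PermutesHalls σ A) : IsSigmaSubnormal σ A := by
  suffices key : ∀ L : Subgroup G, L.Normal → IsSigmaSubnormal σ (A ⊔ L) by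
    simpa using key ⊥ inferInstance
  intro L
  induction L using WellFoundedGT.induction with
  | ind L ih =>
  intro hL
  by_cases hLt : L = ⊤
  · rw [hLt, sup_top_eq]
    exact Relation.ReflTransGen.refl
  obtain ⟨N, hN, hLN, i, hi⟩ := hG L hL hLt
  refine Relation.ReflTransGen.head ?_ (ih N hLN hN)
  have hAL : PermutesHalls σ (A ⊔ L) := fun j H hH => (hA j H hH).sup_left permutes_of_normal
  have hrel : (A ⊔ L).relIndex N = (A ⊔ L).relIndex (A ⊔ N) := by
    refine relIndex_eq_of_subset_mul le_sup_right ?_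
    rw [sup_comm A N, Subgroup.normal_mul]
    exact Set.mul_subset_mul_left (SetLike.coe_subset_coe.2 le_sup_left)
  refine hAL.sigmaSubnormalStep hσ hG (sup_le_sup_left hLN.le A) (i := i) (hi.of_dvd ?_)
  exact hrel ▸ Subgroup.relIndex_dvd_of_le_left _ le_sup_right

theorem isPSigmaTGroup_of_permutesHalls [Finite G] (hσ : IsPrimePartition σ)
    (hG : HasSigmaSeries σ G) (h : ∀ A : Subgroup G, IsSigmaSubnormal σ A → PermutesHalls σ A) :
    IsPSigmaTGroup σ G := by
  intro K H hH hK
  refine (h _ ?_).isSigmaPermutable (hG.isSigmaFull hσ)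
  exact (hH.permutesHalls.isSigmaSubnormal hσ (hG.subgroup K)).map_subtype
    (hK.permutesHalls.isSigmaSubnormal hσ hG)

end Subnormal

/-! ### Power automorphisms -/

section PowerNormalizer

variable {G : Type*} [Group G]

/-- The elements of `G` normalising every cyclic subgroup of `P`. For finite `P` these are the
elements that induce a power automorphism of `P` by conjugation; `P ⊓ powerNormalizer P` is the
norm of `P` in the sense of Baer. -/
def powerNormalizer (P : Subgroup G) : Subgroup G :=
  ⨅ x : P, Subgroup.normalizer (Subgroup.zpowers (x : G) : Set G)

theorem mem_powerNormalizer {P : Subgroup G} {g : G} :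
    g ∈ powerNormalizer P ↔ ∀ x ∈ P, g ∈ Subgroup.normalizer (Subgroup.zpowers x : Set G) := by
  simp [powerNormalizer, Subgroup.mem_iInf]

theorem conj_mem_zpowers {g x : G} (h : g ∈ Subgroup.normalizer (Subgroup.zpowers x : Set G)) :
    g * x * g⁻¹ ∈ Subgroup.zpowers x :=
  (Subgroup.mem_normalizer_iff.1 h x).1 (Subgroup.mem_zpowers x)

theorem conj_mem_zpowers_of_mem_powerNormalizer {P : Subgroup G} {g x : G}
    (hg : g ∈ powerNormalizer P) (hx : x ∈ P) : g * x * g⁻¹ ∈ Subgroup.zpowers x :=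
  conj_mem_zpowers (mem_powerNormalizer.1 hg x hx)

theorem powerNormalizer_anti {P Q : Subgroup G} (h : Q ≤ P) :
    powerNormalizer P ≤ powerNormalizer Q :=
  fun _ hg => mem_powerNormalizer.2 fun x hx => mem_powerNormalizer.1 hg x (h hx)

theorem powerNormalizer_le_normalizer (P : Subgroup G) :
    powerNormalizer P ≤ Subgroup.normalizer (P : Set G) :=
  Subgroup.le_normalizer_iff.2 fun _ hg _ hx =>
    Subgroup.zpowers_le.2 hx (conj_mem_zpowers_of_mem_powerNormalizer hg hx)

theorem conj_mem_normalizer_zpowers {g h x : G}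
    (hg : g ∈ Subgroup.normalizer (Subgroup.zpowers (h⁻¹ * x * h) : Set G)) :
    h * g * h⁻¹ ∈ Subgroup.normalizer (Subgroup.zpowers x : Set G) := by
  have hx : (Subgroup.zpowers (h⁻¹ * x * h)).map (MulAut.conj h).toMonoidHom =
      Subgroup.zpowers x := by
    rw [MonoidHom.map_zpowers]
    congr 1
    simp [mul_assoc]
  have := Subgroup.le_normalizer_map (MulAut.conj h).toMonoidHom
    (Subgroup.mem_map_of_mem (MulAut.conj h).toMonoidHom hg)
  rw [hx] at this
  simpa using this

theorem normalizer_le_normalizer_powerNormalizer (P : Subgroup G) :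
    Subgroup.normalizer (P : Set G) ≤ Subgroup.normalizer (powerNormalizer P : Set G) := by
  refine Subgroup.le_normalizer_iff.2 fun h hh g hg => mem_powerNormalizer.2 fun x hx => ?_
  exact conj_mem_normalizer_zpowers
    (mem_powerNormalizer.1 hg _ ((Subgroup.mem_normalizer_iff''.1 hh x).1 hx))

instance powerNormalizer_normal {P : Subgroup G} [P.Normal] : (powerNormalizer P).Normal := by
  rw [← Subgroup.normalizer_eq_top_iff, eq_top_iff, ← Subgroup.normalizer_eq_top P]
  exact normalizer_le_normalizer_powerNormalizer P

theorem commutator_mem_right {K : Subgroup G} {g x : G}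
    (hg : g ∈ Subgroup.normalizer (K : Set G)) (hx : x ∈ K) : ⁅g, x⁆ ∈ K :=
  K.mul_mem ((Subgroup.mem_normalizer_iff.1 hg x).1 hx) (K.inv_mem hx)

theorem commutator_mem_left {K : Subgroup G} {g x : G}
    (hg : g ∈ Subgroup.normalizer (K : Set G)) (hx : x ∈ K) : ⁅x, g⁆ ∈ K := by
  rw [← commutatorElement_inv]
  exact K.inv_mem (commutator_mem_right hg hx)

theorem commute_of_mem_zpowers {x y : G} (h : y ∈ Subgroup.zpowers x) : Commute y x := by
  obtain ⟨n, rfl⟩ := h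
  exact (Commute.refl x).zpow_left n

theorem commutator_zpow_right {x y : G} (h : Commute ⁅x, y⁆ y) (n : ℤ) :
    ⁅x, y ^ n⁆ = ⁅x, y⁆ ^ n := by
  have hxy : x * y * x⁻¹ = ⁅x, y⁆ * y := by rw [commutatorElement_def, inv_mul_cancel_right]
  rw [commutatorElement_def, ← conj_zpow, hxy, h.mul_zpow, mul_inv_cancel_right]

theorem commutator_zpow_left {x y : G} (h : Commute ⁅x, y⁆ x) (n : ℤ) :
    ⁅x ^ n, y⁆ = ⁅x, y⁆ ^ n := by
  rw [← commutatorElement_inv, commutator_zpow_right, ← inv_zpow, commutatorElement_inv]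
  rw [← commutatorElement_inv]
  exact h.inv_left

theorem IsPElement.commutator_right {q : ℕ} {x y : G} (hy : IsPElement q y)
    (h : Commute ⁅x, y⁆ y) : IsPElement q ⁅x, y⁆ := by
  obtain ⟨l, hl⟩ := hy
  refine ⟨l, ?_⟩
  rw [← zpow_natCast, ← commutator_zpow_right h, zpow_natCast, hl, commutatorElement_one_right]

theorem IsPElement.mem_of_zpow_mem {q : ℕ} (hq : q.Prime) {g : G} (hg : IsPElement q g) {m : ℤ}
    (hm : ¬ (q : ℤ) ∣ m) {S : Subgroup G} (h : g ^ m ∈ S) : g ∈ S := by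
  obtain ⟨l, hl⟩ := hg
  have hcop : IsCoprime m ((q : ℤ) ^ l) :=
    ((Nat.prime_iff_prime_int.1 hq).coprime_iff_not_dvd.2 hm).symm.pow_right
  have hord : (orderOf g : ℤ) ∣ (q : ℤ) ^ l := by exact_mod_cast orderOf_dvd_of_pow_eq_one hl
  exact Subgroup.zpowers_le.2 h (mem_zpowers_zpow_iff.2
    (Int.isCoprime_iff_gcd_eq_one.1 (hcop.of_isCoprime_of_dvd_right hord)))

end PowerNormalizer

section PowerAction

variable {G : Type*} [Group G]

theorem zpow_eq_self_iff {x : G} {m : ℤ} : x ^ m = x ↔ (orderOf x : ℤ) ∣ m - 1 := by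
  rw [orderOf_dvd_iff_zpow_eq_one, zpow_sub_one, mul_inv_eq_one]

theorem conj_eq_zpow_of_mem_zpowers {g x y : G} {n : ℤ} (h : g * x * g⁻¹ = x ^ n)
    (hy : y ∈ Subgroup.zpowers x) : g * y * g⁻¹ = y ^ n := by
  obtain ⟨s, rfl⟩ := hy
  rw [← conj_zpow, h, ← zpow_mul, ← zpow_mul, mul_comm]

theorem pow_conj_eq_zpow {g y : G} {n : ℤ} (h : g * y * g⁻¹ = y ^ n) (r : ℕ) :
    g ^ r * y * (g ^ r)⁻¹ = y ^ (n ^ r) := by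
  induction r with
  | zero => simp
  | succ r ih =>
    calc g ^ (r + 1) * y * (g ^ (r + 1))⁻¹ = g * (g ^ r * y * (g ^ r)⁻¹) * g⁻¹ := by
          rw [pow_succ']; group
      _ = y ^ (n ^ (r + 1)) := by rw [ih, ← conj_zpow, h, ← zpow_mul, pow_succ']

theorem exists_common_zpow {p : ℕ} (hp : p.Prime) {P : Subgroup G} {g x z : G}
    (hg : g ∈ powerNormalizer P) (hxP : x ∈ P) (hzP : z ∈ P) (hxz : Commute x z)
    (hx : x ^ p = 1) : ∃ m : ℤ, g * x * g⁻¹ = x ^ m ∧ g * z * g⁻¹ = z ^ m := by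
  obtain ⟨n, hn : x ^ n = _⟩ := conj_mem_zpowers_of_mem_powerNormalizer hg hxP
  obtain ⟨k, hk : z ^ k = _⟩ := conj_mem_zpowers_of_mem_powerNormalizer hg hzP
  obtain ⟨m, hm : (x * z) ^ m = _⟩ :=
    conj_mem_zpowers_of_mem_powerNormalizer hg (P.mul_mem hxP hzP)
  by_cases hxmem : x ∈ Subgroup.zpowers z
  · exact ⟨k, conj_eq_zpow_of_mem_zpowers hk.symm hxmem, hk.symm⟩
  have hprod : x ^ m * z ^ m = x ^ n * z ^ k := by
    rw [← hxz.mul_zpow, hm, hn, hk]; group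
  have hquot : x ^ (m - n) = z ^ (k - m) := by
    rw [sub_eq_neg_add, zpow_add, zpow_sub, eq_mul_inv_iff_mul_eq, mul_assoc, hprod, zpow_neg,
      inv_mul_cancel_left]
  have hdvd : (p : ℤ) ∣ m - n := by
    by_contra hndvd
    refine hxmem (IsPElement.mem_of_zpow_mem hp ⟨1, by rwa [pow_one]⟩ hndvd ?_)
    exact hquot ▸ Subgroup.zpow_mem_zpowers z _
  have hone : x ^ (m - n) = 1 := by
    obtain ⟨c, hc⟩ := hdvd
    rw [hc, zpow_mul, zpow_natCast, hx, one_zpow]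
  refine ⟨m, ?_, ?_⟩
  · rw [← hn, eq_comm, ← mul_inv_eq_one, ← zpow_sub, hone]
  · rw [← hk, ← mul_inv_eq_one, ← zpow_sub, ← hquot, hone]

theorem commute_of_commute_of_orderOf_eq {p : ℕ} (hp : p.Prime) {P : Subgroup G} {g x z : G}
    (hg : g ∈ powerNormalizer P) (hxP : x ∈ P) (hzP : z ∈ P) (hxz : Commute x z)
    (hx : orderOf x = p) (hz : orderOf z = p) (hgz : Commute g z) : Commute g x := by
  obtain ⟨m, hxm, hzm⟩ := exists_common_zpow hp hg hxP hzP hxz (hx ▸ pow_orderOf_eq_one x)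
  rw [hgz.mul_inv_cancel, eq_comm, zpow_eq_self_iff, hz, ← hx, ← zpow_eq_self_iff] at hzm
  exact mul_inv_eq_iff_eq_mul.1 (hxm.trans hzm)

theorem IsPElement.exists_orderOf_eq {p : ℕ} (hp : p.Prime) {y : G} (h : IsPElement p y)
    (hy : y ≠ 1) : ∃ k : ℕ, orderOf y = p ^ (k + 1) := by
  have := Fact.mk hp
  obtain ⟨_ | k, hk⟩ := exists_orderOf_eq_prime_pow_iff.2 h
  · exact absurd (orderOf_eq_one_iff.1 (by simpa using hk)) hy
  · exact ⟨k, hk⟩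

theorem orderOf_pow_prime_pow {p k : ℕ} (hp : p.Prime) {y : G} (hy : orderOf y = p ^ (k + 1)) :
    orderOf (y ^ p ^ k) = p := by
  rw [orderOf_pow_of_dvd (pow_pos hp.pos k).ne' (hy ▸ pow_dvd_pow p k.le_succ), hy,
    Nat.pow_div k.le_succ hp.pos, Nat.succ_sub (le_refl k), Nat.sub_self, pow_one]

/-- If `g` acts on `⟨y⟩` as the `n`-th power, then `n ≡ 1` modulo `p`, so `n ^ p ^ k ≡ 1` modulo
the order of `y`, and `g ^ p ^ k`, of which `g` is a power, centralises `y`. -/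
theorem commute_of_commute_pow {p q k : ℕ} (hp : p.Prime) (hq : q.Prime) (hpq : p ≠ q) {g y : G}
    (hg : IsPElement q g) (hy : orderOf y = p ^ (k + 1))
    (hgy : g ∈ Subgroup.normalizer (Subgroup.zpowers y : Set G)) (hc : Commute g (y ^ p ^ k)) :
    Commute g y := by
  obtain ⟨n, hn : y ^ n = _⟩ := conj_mem_zpowers hgy
  have hmod : (p : ℤ) ∣ n - 1 := by
    have hzn := conj_eq_zpow_of_mem_zpowers hn.symm (Subgroup.npow_mem_zpowers y (p ^ k))
    rwa [hc.mul_inv_cancel, eq_comm, zpow_eq_self_iff, orderOf_pow_prime_pow hp hy] at hzn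
  have hpow : y ^ (n ^ p ^ k) = y := by
    rw [zpow_eq_self_iff, hy]
    simpa using dvd_sub_pow_of_dvd_sub hmod k
  have hgpow : g ^ (p ^ k) ∈ Subgroup.centralizer {y} := by
    rw [Subgroup.mem_centralizer_singleton_iff, ← mul_inv_eq_iff_eq_mul]
    exact (pow_conj_eq_zpow hn.symm (p ^ k)).trans hpow
  refine Subgroup.mem_centralizer_singleton_iff.1 (hg.mem_of_zpow_mem hq (m := (p ^ k : ℕ)) ?_ ?_)
  · rw [Int.natCast_dvd_natCast]
    exact fun hd => hpq ((Nat.prime_dvd_prime_iff_eq hq hp).1 (hq.dvd_of_dvd_pow hd)).symm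
  · rwa [zpow_natCast]

/-- The action is first compared with that on a central element of order `p`, whose products with
the other elements of order `p` are again of order `p`. -/
theorem commute_of_mem_powerNormalizer {p q : ℕ} (hp : p.Prime) (hq : q.Prime) (hpq : p ≠ q)
    {P : Subgroup G} [Finite P] (hP : IsPGroup p P) {g : G} (hgP : g ∈ powerNormalizer P)
    (hg : IsPElement q g) {x : G} (hx : x ∈ P) (hx1 : x ≠ 1) (hgx : Commute g x) {y : G}
    (hy : y ∈ P) : Commute g y := by
  have := Fact.mk hp
  have : Nontrivial P := ⟨⟨x, hx⟩, 1, by simpa [Subtype.ext_iff] using hx1⟩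
  have := hP.center_nontrivial
  obtain ⟨⟨⟨w, hwP⟩, hwc⟩, hw1⟩ := exists_ne (1 : Subgroup.center P)
  replace hw1 : w ≠ 1 := fun h => hw1 (Subtype.ext (Subtype.ext h))
  have hwcomm : ∀ z ∈ P, Commute z w := fun z hz =>
    congrArg Subtype.val (Subgroup.mem_center_iff.1 hwc ⟨z, hz⟩)
  obtain ⟨k, hk⟩ := (isPElement_of_mem hP hwP).exists_orderOf_eq hp hw1
  obtain ⟨l, hl⟩ := (isPElement_of_mem hP hx).exists_orderOf_eq hp hx1
  have hgw : Commute g (w ^ p ^ k) :=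
    commute_of_commute_of_orderOf_eq hp hgP (P.pow_mem hwP _) (P.pow_mem hx _)
      ((hwcomm x hx).symm.pow_pow _ _) (orderOf_pow_prime_pow hp hk) (orderOf_pow_prime_pow hp hl)
      (hgx.pow_right _)
  by_cases hy1 : y = 1
  · rw [hy1]; exact Commute.one_right g
  obtain ⟨m, hm⟩ := (isPElement_of_mem hP hy).exists_orderOf_eq hp hy1
  refine commute_of_commute_pow hp hq hpq hg hm (mem_powerNormalizer.1 hgP y hy) ?_
  exact commute_of_commute_of_orderOf_eq hp hgP (P.pow_mem hy _) (P.pow_mem hwP _)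
    ((hwcomm y hy).pow_pow _ _) (orderOf_pow_prime_pow hp hm) (orderOf_pow_prime_pow hp hk) hgw

theorem exists_commutator_eq {P : Subgroup G} [Finite P] {g : G}
    (hg : g ∈ Subgroup.normalizer (P : Set G)) (hfix : ∀ x ∈ P, Commute g x → x = 1) {x : G}
    (hx : x ∈ P) : ∃ y ∈ P, ⁅y, g⁆ = x := by
  let φ : P → P := fun y => ⟨⁅(y : G), g⁆, commutator_mem_left hg y.2⟩
  have hinj : Function.Injective φ := by
    rintro ⟨y, hy⟩ ⟨z, hz⟩ h
    have hyz : ⁅y, g⁆ = ⁅z, g⁆ := congrArg Subtype.val h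
    have hc : g * (z⁻¹ * y) * g⁻¹ = z⁻¹ * y := by
      calc g * (z⁻¹ * y) * g⁻¹ = z⁻¹ * ⁅z, g⁆ * ⁅y, g⁆⁻¹ * y := by
            simp only [commutatorElement_def]; group
        _ = z⁻¹ * y := by rw [hyz, mul_inv_cancel_right]
    have := hfix _ (P.mul_mem (P.inv_mem hz) hy) (mul_inv_eq_iff_eq_mul.1 hc)
    exact Subtype.ext (inv_mul_eq_one.1 this).symm
  obtain ⟨⟨y, hy⟩, h⟩ := Finite.surjective_of_injective hinj ⟨x, hx⟩
  exact ⟨y, hy, congrArg Subtype.val h⟩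

theorem le_powerNormalizer_of_fixedPointFree {P : Subgroup G} [Finite P] {g : G}
    (hg : g ∈ powerNormalizer P) (hfix : ∀ x ∈ P, Commute g x → x = 1) :
    P ≤ powerNormalizer P := by
  intro x hx
  obtain ⟨y, hy, rfl⟩ := exists_commutator_eq (powerNormalizer_le_normalizer P hg) hfix hx
  exact commutator_mem_right
    (normalizer_le_normalizer_powerNormalizer P (Subgroup.le_normalizer hy)) hg

theorem commute_of_fixedPointFree {P : Subgroup G} [Finite P] {g : G}
    (hg : g ∈ powerNormalizer P) (hfix : ∀ x ∈ P, Commute g x → x = 1) {x y : G} (hx : x ∈ P)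
    (hy : y ∈ P) : Commute x y := by
  have hP := le_powerNormalizer_of_fixedPointFree hg hfix
  have hcx : ⁅x, y⁆ ∈ Subgroup.zpowers x :=
    commutator_mem_left (mem_powerNormalizer.1 (hP hy) x hx) (Subgroup.mem_zpowers x)
  have hcy : ⁅x, y⁆ ∈ Subgroup.zpowers y :=
    commutator_mem_right (mem_powerNormalizer.1 (hP hx) y hy) (Subgroup.mem_zpowers y)
  obtain ⟨n, hn : x ^ n = _⟩ := conj_mem_zpowers_of_mem_powerNormalizer hg hx
  obtain ⟨m, hm : y ^ m = _⟩ := conj_mem_zpowers_of_mem_powerNormalizer hg hy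
  have hgn := conj_eq_zpow_of_mem_zpowers hn.symm hcx
  have hgm := conj_eq_zpow_of_mem_zpowers hm.symm hcy
  have hgmn : g * ⁅x, y⁆ * g⁻¹ = (g * ⁅x, y⁆ * g⁻¹) ^ m := by
    have hcxm : Commute ⁅x, y ^ m⁆ x := by
      rw [commutator_zpow_right (commute_of_mem_zpowers hcy)]
      exact (commute_of_mem_zpowers hcx).zpow_left m
    calc g * ⁅x, y⁆ * g⁻¹ = ⁅x ^ n, y ^ m⁆ := by rw [conjugate_commutatorElement, hn, hm]
      _ = (⁅x, y⁆ ^ n) ^ m := by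
        rw [commutator_zpow_left hcxm, commutator_zpow_right (commute_of_mem_zpowers hcy),
          ← zpow_mul, ← zpow_mul, mul_comm]
      _ = (g * ⁅x, y⁆ * g⁻¹) ^ m := by rw [hgn]
  have hfixed : g * ⁅x, y⁆ * g⁻¹ = ⁅x, y⁆ := by
    rw [conj_zpow, ← hgm] at hgmn
    simpa using hgmn.symm
  exact commutatorElement_eq_one_iff_commute.1
    (hfix _ (Subgroup.zpowers_le.2 hx hcx) (mul_inv_eq_iff_eq_mul.1 hfixed))

end PowerAction

section MinimalNormal

variable {G : Type*} [Group G] {N : Subgroup G}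

theorem commute_of_commutator_mem {p q : ℕ} (hp : p.Prime) (hq : q.Prime) (hpq : p ≠ q)
    {P Q : Subgroup G} (hP : IsPGroup p P) (hQ : IsPGroup q Q) {x y : G} (hxyP : ⁅x, y⁆ ∈ P)
    (hxyQ : ⁅x, y⁆ ∈ Q) : Commute x y :=
  commutatorElement_eq_one_iff_commute.1 <|
    (isPElement_of_mem hP hxyP).eq_one_of_ne hp hq hpq (isPElement_of_mem hQ hxyQ)

theorem isPGroup_of_isPiGroup [Finite G] {p : ℕ} {K : Subgroup G} (h : IsPiGroup {p} K) :
    IsPGroup p K :=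
  IsPGroup.of_card (n := (Nat.card K).primeFactorsList.length)
    (Nat.eq_prime_pow_of_unique_prime_dvd Nat.card_pos.ne' fun hq hd => h _ hq hd)

theorem isPGroup_of_minimal_normal [Finite G]
    (hN : Minimal (fun M : Subgroup G => M.Normal ∧ ⊥ < M) N) (hnorm : N ≤ powerNormalizer N)
    {p : ℕ} (hp : p.Prime) (hd : p ∣ Nat.card N) : IsPGroup p N := by
  have := hN.prop.1
  have hpi : IsPiGroup {p} (piGenerated {p} N) := by
    refine isPiGroup_piGenerated fun r q hr hq hrp hqp x hx y hy hxr hyq => ?_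
    obtain rfl : r = p := hrp
    refine commute_of_commutator_mem hr hq (Ne.symm hqp) hxr.isPGroup_zpowers
      hyq.isPGroup_zpowers ?_ ?_
    · exact commutator_mem_left (mem_powerNormalizer.1 (hnorm hy) x hx) (Subgroup.mem_zpowers x)
    · exact commutator_mem_right (mem_powerNormalizer.1 (hnorm hx) y hy) (Subgroup.mem_zpowers y)
  obtain ⟨⟨x, hxN⟩, hx1, hxp⟩ := exists_ne_one_pow_eq_one hp hd
  have hx : x ∈ piGenerated {p} N :=
    mem_piGenerated hp (Set.mem_singleton p) hxN ⟨1, by simpa using congrArg Subtype.val hxp⟩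
  have hne : piGenerated {p} N ≠ ⊥ := fun h =>
    hx1 (Subtype.ext (Subgroup.mem_bot.1 (h ▸ hx)))
  have heq : piGenerated {p} N = N :=
    hN.eq_of_le ⟨inferInstance, hne.bot_lt⟩ piGenerated_le_self
  exact isPGroup_of_isPiGroup (heq ▸ hpi)

theorem commute_of_minimal_normal_of_isPGroup [Finite G] {p : ℕ} (hp : p.Prime)
    (hN : Minimal (fun M : Subgroup G => M.Normal ∧ ⊥ < M) N) (hNp : IsPGroup p N)
    {x y : G} (hx : x ∈ N) (hy : y ∈ N) : Commute x y := by
  have := Fact.mk hp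
  have := hN.prop.1
  have := (Subgroup.nontrivial_iff_ne_bot N).2 hN.prop.2.ne'
  have hne : (Subgroup.center N).map N.subtype ≠ ⊥ := by
    rw [Ne, Subgroup.map_eq_bot_iff_of_injective _ N.subtype_injective, ← Ne,
      ← Subgroup.nontrivial_iff_ne_bot]
    exact hNp.center_nontrivial
  have hcenter : (Subgroup.center N).map N.subtype = N :=
    hN.eq_of_le ⟨ConjAct.normal_of_characteristic_of_normal (K := Subgroup.center N), hne.bot_lt⟩
      (Subgroup.map_subtype_le _)
  rw [← hcenter] at hx
  obtain ⟨z, hz, rfl⟩ := hx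
  exact (congrArg Subtype.val (Subgroup.mem_center_iff.1 hz ⟨y, hy⟩)).symm

theorem pow_eq_one_of_minimal_normal [Finite G] {p : ℕ} (hp : p.Prime)
    (hN : Minimal (fun M : Subgroup G => M.Normal ∧ ⊥ < M) N)
    (hcomm : ∀ x ∈ N, ∀ y ∈ N, Commute x y) (hd : p ∣ Nat.card N) {x : G} (hx : x ∈ N) :
    x ^ p = 1 := by
  have := hN.prop.1
  let Ω : Subgroup G :=
    { carrier := {y | y ∈ N ∧ y ^ p = 1}
      one_mem' := ⟨N.one_mem, one_pow p⟩
      mul_mem' := fun {y z} hy hz =>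
        ⟨N.mul_mem hy.1 hz.1, by rw [(hcomm y hy.1 z hz.1).mul_pow, hy.2, hz.2, one_mul]⟩
      inv_mem' := fun {y} hy => ⟨N.inv_mem hy.1, by rw [inv_pow, hy.2, inv_one]⟩ }
  have hΩ : Ω.Normal := ⟨fun y hy g => ⟨Subgroup.Normal.conj_mem inferInstance y hy.1 g, by
    rw [conj_pow, hy.2, mul_one, mul_inv_cancel]⟩⟩
  obtain ⟨⟨y, hyN⟩, hy1, hyp⟩ := exists_ne_one_pow_eq_one hp hd
  have hy : y ∈ Ω := ⟨hyN, by simpa using congrArg Subtype.val hyp⟩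
  have hne : Ω ≠ ⊥ := fun h => hy1 (Subtype.ext (Subgroup.mem_bot.1 (h ▸ hy)))
  have hΩN : Ω = N := hN.eq_of_le ⟨hΩ, hne.bot_lt⟩ fun y hy => hy.1
  rw [← hΩN] at hx
  exact hx.2

theorem le_powerNormalizer_of_minimal_normal
    (hN : Minimal (fun M : Subgroup G => M.Normal ∧ ⊥ < M) N) {g y : G}
    (hg : g ∈ powerNormalizer N) (hy : y ∈ N) (hgy : ¬ Commute g y) : N ≤ powerNormalizer N := by
  have := hN.prop.1
  have hmem : ⁅g, y⁆ ∈ N ⊓ powerNormalizer N :=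
    ⟨commutator_mem_right (powerNormalizer_le_normalizer N hg) hy,
      commutator_mem_left (Subgroup.le_normalizer_of_normal (Subgroup.mem_top y)) hg⟩
  have hne : N ⊓ powerNormalizer N ≠ ⊥ := fun h => by
    rw [h, Subgroup.mem_bot, commutatorElement_eq_one_iff_commute] at hmem
    exact hgy hmem
  exact (hN.eq_of_le ⟨inferInstance, hne.bot_lt⟩ inf_le_left).ge.trans inf_le_right

/-- All elements of an elementary abelian group are raised to the same power by `g`, which
therefore acts as a scalar. -/
theorem commute_commutator_of_elementary {p : ℕ} (hp : p.Prime) [N.Normal]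
    (hcomm : ∀ x ∈ N, ∀ y ∈ N, Commute x y) (hexp : ∀ x ∈ N, x ^ p = 1) {g : G}
    (hg : g ∈ powerNormalizer N) (k : G) {x : G} (hx : x ∈ N) : Commute ⁅k, g⁆ x := by
  have hN : N.Normal := inferInstance
  have hu : g⁻¹ * x * g ∈ N := by simpa using hN.conj_mem x hx g⁻¹
  have hv : k⁻¹ * (g⁻¹ * x * g) * k ∈ N := by simpa using hN.conj_mem _ hu k⁻¹
  obtain ⟨m, hum, hvm⟩ := exists_common_zpow hp hg hu hv (hcomm _ hu _ hv) (hexp _ hu)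
  refine mul_inv_eq_iff_eq_mul.1 ?_
  calc ⁅k, g⁆ * x * ⁅k, g⁆⁻¹ = k * (g * (k⁻¹ * (g⁻¹ * x * g) * k) * g⁻¹) * k⁻¹ := by
        rw [commutatorElement_def]; group
    _ = (k * (k⁻¹ * (g⁻¹ * x * g) * k) * k⁻¹) ^ m := by rw [hvm, conj_zpow]
    _ = (g⁻¹ * x * g) ^ m := by congr 1; group
    _ = x := by rw [← hum]; group

theorem commute_commutator_of_minimal_normal [Finite G]
    (hN : Minimal (fun M : Subgroup G => M.Normal ∧ ⊥ < M) N) {g : G}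
    (hg : g ∈ powerNormalizer N) (k : G) {x : G} (hx : x ∈ N) : Commute ⁅k, g⁆ x := by
  have := hN.prop.1
  by_cases hcentral : g ∈ Subgroup.centralizer (N : Set G)
  · have hk : k ∈ Subgroup.normalizer (Subgroup.centralizer (N : Set G) : Set G) :=
      Subgroup.le_normalizer_of_normal (Subgroup.mem_top k)
    exact (Subgroup.mem_centralizer_iff.1 (commutator_mem_right hk hcentral) x hx).symm
  obtain ⟨y, hy, hgy⟩ : ∃ y ∈ N, ¬ Commute g y := by
    by_contra! h
    exact hcentral (Subgroup.mem_centralizer_iff.2 fun y hy => (h y hy).symm)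
  have hnorm := le_powerNormalizer_of_minimal_normal hN hg hy hgy
  obtain ⟨p, hp, hd⟩ := Nat.exists_prime_and_dvd
    (fun h => hN.prop.2.ne' (Subgroup.card_eq_one.1 h) : Nat.card N ≠ 1)
  have hNp := isPGroup_of_minimal_normal hN hnorm hp hd
  have hcomm : ∀ x ∈ N, ∀ y ∈ N, Commute x y := fun x hx y hy =>
    commute_of_minimal_normal_of_isPGroup hp hN hNp hx hy
  exact commute_commutator_of_elementary hp hcomm
    (fun x hx => pow_eq_one_of_minimal_normal hp hN hcomm hd hx) hg k hx

end MinimalNormal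

/-! ### Action on normal `σ i`-sections -/

section Sections

variable {I : Type v} {σ : I → Set ℕ} {G G' : Type*} [Group G] [Group G'] {i : I}

/-- The `σ i'`-elements of `G` normalise every subgroup of every normal `σ i`-section `N / L` of
`G`, a subgroup of the section being given as `A` with `L ≤ A ≤ N`. -/
def NormalisesSections (σ : I → Set ℕ) (G : Type*) [Group G] : Prop :=
  ∀ (i : I) (L N A : Subgroup G), L.Normal → N.Normal → L ≤ A → A ≤ N →
    IsPiNumber (σ i) (L.relIndex N) → ∀ q : ℕ, q.Prime → q ∉ σ i → ∀ g : G, IsPElement q g →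
      g ∈ Subgroup.normalizer (A : Set G)

theorem normalizer_of_permutes {A K N : Subgroup G} [N.Normal] (hAN : A ≤ N)
    (h : Permutes A K) (hKN : K ⊓ N ≤ A) : K ≤ Subgroup.normalizer (A : Set G) := by
  refine Subgroup.le_normalizer_iff.2 fun k hk a ha => ?_
  obtain ⟨b, hb, l, hl, hbl : b * l = k * a⟩ : k * a ∈ (A : Set G) * K :=
    h ▸ Set.mul_mem_mul hk ha
  have hconj : k * a * k⁻¹ = b * (l * k⁻¹) := by rw [← hbl, mul_assoc]
  have hlN : l * k⁻¹ ∈ N := by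
    rw [← N.mul_mem_cancel_left (hAN hb), ← hconj]
    exact Subgroup.Normal.conj_mem inferInstance a (hAN ha) k
  rw [hconj]
  exact A.mul_mem hb (hKN ⟨K.mul_mem hl (K.inv_mem hk), hlN⟩)

theorem normalisesSections_of_permutesHalls [Finite G] (hσ : IsPrimePartition σ)
    (hG : HasSigmaSeries σ G) (h : ∀ A : Subgroup G, IsSigmaSubnormal σ A → PermutesHalls σ A) :
    NormalisesSections σ G := by
  intro i L N A hL hN hLA hAN hi q hq hqi g hg
  have hstep : SigmaSubnormalStep σ A N := sigmaSubnormalStep_iff.2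
    ⟨hAN, Or.inr ⟨i, L, hLA, Subgroup.le_normalizer_of_normal, hi⟩⟩
  have hA : PermutesHalls σ A := h A (Relation.ReflTransGen.head hstep isSigmaSubnormal_of_normal)
  obtain ⟨j, hj⟩ := hσ.exists_mem hq
  obtain ⟨H, hH⟩ := hG.exists_isHallPi hσ j
  obtain ⟨K, hK, hgK⟩ := hH.exists_mem hq hj hg
  have hij : i ≠ j := by rintro rfl; exact hqi hj
  exact normalizer_of_permutes hAN (hA j K hK) ((hA j K hK).inf_le hσ hij hAN hK.1
    (hi.of_dvd (Subgroup.relIndex_dvd_of_le_left N hLA))) hgK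

theorem NormalisesSections.of_surjective [Finite G] (h : NormalisesSections σ G) {f : G →* G'}
    (hf : Function.Surjective f) : NormalisesSections σ G' := by
  intro i L N A hL hN hLA hAN hi q hq hqi g hg
  obtain ⟨g, hg', rfl⟩ := hg.exists_lift hq hf
  have hmem := h i (L.comap f) (N.comap f) (A.comap f) (hL.comap f) (hN.comap f)
    (Subgroup.comap_mono hLA) (Subgroup.comap_mono hAN) (relIndex_comap_comap hf N L ▸ hi)
    q hq hqi g hg'
  rw [Subgroup.mem_normalizer_iff, hf.forall]
  simpa using Subgroup.mem_normalizer_iff.1 hmem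

theorem NormalisesSections.mem_powerNormalizer (h : NormalisesSections σ G) {N : Subgroup G}
    [hN : N.Normal] (hi : IsPiGroup (σ i) N) {q : ℕ} (hq : q.Prime) (hqi : q ∉ σ i) {g : G}
    (hg : IsPElement q g) : g ∈ powerNormalizer N :=
  SigmaTheory.mem_powerNormalizer.2 fun x hx =>
    h i ⊥ N (Subgroup.zpowers x) inferInstance hN bot_le (Subgroup.zpowers_le.2 hx)
      (by rwa [Subgroup.relIndex_bot_left]) q hq hqi g hg

theorem NormalisesSections.sigmaCommutator_le_centralizer [Finite G]
    (h : NormalisesSections σ G) {N : Subgroup G}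
    (hN : Minimal (fun M : Subgroup G => M.Normal ∧ ⊥ < M) N) (hi : IsPiGroup (σ i) N) :
    sigmaCommutator σ G ≤ Subgroup.centralizer N := by
  have := hN.prop.1
  refine sigmaCommutator_le fun p q hpq y z hy hz => ?_
  refine Subgroup.mem_centralizer_iff.2 fun x hx => ?_
  by_cases hqi : q ∈ σ i
  · rw [← commutatorElement_inv]
    exact (commute_commutator_of_minimal_normal hN
      (h.mem_powerNormalizer hi hpq.1 (hpq.symm.2.2 i hqi) hy) z hx).inv_left.symm
  · exact (commute_commutator_of_minimal_normal hN
      (h.mem_powerNormalizer hi hpq.2.1 hqi hz) y hx).symm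

theorem IsPElement.commute_of_commute_commutator {p q : ℕ} (hp : p.Prime) (hq : q.Prime)
    (hpq : p ≠ q) {x y : G} (hx : IsPElement p x) (hy : IsPElement q y)
    (hcx : Commute ⁅x, y⁆ x) (hcy : Commute ⁅x, y⁆ y) : Commute x y := by
  rw [← commutatorElement_inv y x] at hcx
  have hxy : IsPElement p ⁅x, y⁆ := by
    rw [← commutatorElement_inv]
    exact (hx.commutator_right (Commute.inv_left_iff.1 hcx)).inv
  exact commutatorElement_eq_one_iff_commute.1
    (hxy.eq_one_of_ne hp hq hpq (hy.commutator_right hcy))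

/-- The residual is nilpotent, because it centralises the chief factors of `G`. -/
theorem NormalisesSections.commute_of_isPElement [Finite G]
    (hG : IsSigmaSoluble σ G) (h : NormalisesSections σ G) {p q : ℕ} (hp : p.Prime) (hq : q.Prime)
    (hpq : p ≠ q) {x y : G} (hx : x ∈ sigmaCommutator σ G) (hy : y ∈ sigmaCommutator σ G)
    (hxp : IsPElement p x) (hyq : IsPElement q y) : Commute x y := by
  induction hn : Nat.card G using Nat.strong_induction_on generalizing G with
  | _ n ih =>
  subst hn
  rcases eq_or_ne (sigmaCommutator σ G) ⊥ with hD | hD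
  · rw [hD, Subgroup.mem_bot] at hx
    rw [hx]
    exact Commute.one_left y
  obtain ⟨N, -, hN, i, hi⟩ := hG.exists_minimal_normal (σ := σ) (L := ⊥) inferInstance
    (sigmaCommutator_normal (σ := σ)) hD.bot_lt
  rw [Subgroup.relIndex_bot_left] at hi
  have := hN.prop.1
  have hf := QuotientGroup.mk'_surjective N
  have hmap : ∀ d ∈ sigmaCommutator σ G, QuotientGroup.mk' N d ∈ sigmaCommutator σ (G ⧸ N) :=
    fun d hd => map_sigmaCommutator (σ := σ) hf ▸ Subgroup.mem_map_of_mem _ hd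
  have hlt : Nat.card (G ⧸ N) < Nat.card G := by
    rw [N.card_eq_card_quotient_mul_card_subgroup]
    exact lt_mul_of_one_lt_right Nat.card_pos (N.one_lt_card_iff_ne_bot.2 hN.prop.2.ne')
  have hcomm : ⁅QuotientGroup.mk' N x, QuotientGroup.mk' N y⁆ = 1 :=
    commutatorElement_eq_one_iff_commute.2 (ih _ hlt (hG.of_surjective hf) (h.of_surjective hf)
      (hmap x hx) (hmap y hy) (hxp.map _) (hyq.map _) rfl)
  rw [← map_commutatorElement, QuotientGroup.mk'_apply, QuotientGroup.eq_one_iff] at hcomm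
  have hcentral : ∀ d ∈ sigmaCommutator σ G, Commute ⁅x, y⁆ d := fun d hd =>
    Subgroup.mem_centralizer_iff.1 (h.sigmaCommutator_le_centralizer hN hi hd) _ hcomm
  exact hxp.commute_of_commute_commutator hp hq hpq hyq (hcentral x hx) (hcentral y hy)

end Sections

section LocalResidual

variable {I : Type v} {σ : I → Set ℕ} {G : Type*} [Group G] {i : I} {p : ℕ}

theorem exists_not_commute_sigmaCommutator (hp : p.Prime) (hpi : p ∈ σ i)
    (hD : sigmaCommutator σ G ≠ ⊥) (hDp : IsPGroup p (sigmaCommutator σ G)) :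
    ∃ q : ℕ, q.Prime ∧ q ∉ σ i ∧ ∃ g : G, IsPElement q g ∧
      ∃ x ∈ sigmaCommutator σ G, ¬ Commute g x := by
  by_contra! hcon
  have hcomm : ∀ r s : ℕ, AreSeparated σ r s → s ∉ σ i → ∀ x y : G, IsPElement r x →
      IsPElement s y → Commute x y := by
    intro r s hrs hsi x y hx hy
    have hxy : ⁅x, y⁆ ∈ sigmaCommutator σ G := commutator_mem_sigmaCommutator hrs hx hy
    rw [← commutatorElement_eq_one_iff_commute]
    exact (isPElement_of_mem hDp hxy).eq_one_of_ne hp hrs.2.1 (by rintro rfl; exact hsi hpi)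
      (hy.commutator_right (hcon s hrs.2.1 hsi y hy _ hxy).symm)
  refine hD (sigmaCommutator_eq_bot_iff.2 fun r s hrs x y hx hy => ?_)
  by_cases hsi : s ∈ σ i
  · exact (hcomm s r hrs.symm (hrs.symm.2.2 i hsi) y x hy hx).symm
  · exact hcomm r s hrs hsi x y hx hy

theorem isPiGroup_piGenerated_sup [Finite G] (hσ : IsPrimePartition σ)
    (hD : IsPiGroup (σ i) (sigmaCommutator σ G)) :
    IsPiGroup (σ i) (piGenerated (σ i) (⊤ : Subgroup G) ⊔ sigmaCommutator σ G : Subgroup G) := by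
  have h : IsPiNumber (σ i) _ :=
    IsPiNumber.mul hD (isPiNumber_relIndex_piGenerated_sup (G := G) hσ i)
  rwa [← Subgroup.relIndex_bot_left, Subgroup.relIndex_mul_relIndex _ _ _ bot_le le_sup_right,
    Subgroup.relIndex_bot_left] at h

theorem not_two_dvd_card_of_fixedPointFree {P : Subgroup G} [Finite P] {g : G}
    (hg : g ∈ powerNormalizer P) (hfix : ∀ x ∈ P, Commute g x → x = 1) : ¬ 2 ∣ Nat.card P := by
  intro hd
  obtain ⟨⟨x, hx⟩, hx1, hx2⟩ := exists_ne_one_pow_eq_one Nat.prime_two hd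
  replace hx1 : x ≠ 1 := fun h => hx1 (Subtype.ext h)
  replace hx2 : orderOf x = 2 := orderOf_eq_prime (by simpa using congrArg Subtype.val hx2) hx1
  obtain ⟨n, hn : x ^ n = _⟩ := conj_mem_zpowers_of_mem_powerNormalizer hg hx
  have hodd : ¬ (2 : ℤ) ∣ n := fun h => by
    have hxn : x ^ n = 1 := orderOf_dvd_iff_zpow_eq_one.1 (by rwa [hx2])
    exact hx1 (conj_eq_one_iff.1 (hn.symm.trans hxn))
  have hxn : x ^ n = x := zpow_eq_self_iff.2 (by rw [hx2]; omega)
  exact hx1 (hfix x hx (mul_inv_eq_iff_eq_mul.1 (hn.symm.trans hxn)))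

theorem NormalisesSections.exists_fixedPointFree [Finite G] (hσ : IsPrimePartition σ)
    (h : NormalisesSections σ G) (hp : p.Prime) (hpi : p ∈ σ i)
    (hD : sigmaCommutator σ G ≠ ⊥) (hDp : IsPGroup p (sigmaCommutator σ G)) :
    ¬ p ∣ (sigmaCommutator σ G).index ∧
      ∃ g ∈ powerNormalizer (piGenerated (σ i) (⊤ : Subgroup G) ⊔ sigmaCommutator σ G),
        ∀ x ∈ sigmaCommutator σ G, Commute g x → x = 1 := by
  have := Fact.mk hp
  obtain ⟨q, hq, hqi, g, hg, d, hd, hgd⟩ := exists_not_commute_sigmaCommutator hp hpi hD hDp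
  have hDi : IsPiGroup (σ i) (sigmaCommutator σ G) := isPiGroup_coe_iff.2 fun r hr hri x hx hxr =>
    hxr.eq_one_of_ne hr hp (by rintro rfl; exact hri hpi) (isPElement_of_mem hDp hx)
  have hgH := h.mem_powerNormalizer (isPiGroup_piGenerated_sup hσ hDi) hq hqi hg
  obtain ⟨P, hDP⟩ := hDp.exists_le_sylow
  have hgP : g ∈ powerNormalizer (P : Subgroup G) := powerNormalizer_anti (fun x hx =>
    Subgroup.mem_sup_left (mem_piGenerated hp hpi (Subgroup.mem_top x)
      (isPElement_of_mem P.isPGroup' hx))) hgH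
  have hfix : ∀ x ∈ (P : Subgroup G), Commute g x → x = 1 := fun x hx hgx => by
    by_contra hx1
    exact hgd (commute_of_mem_powerNormalizer hp hq (by rintro rfl; exact hqi hpi) P.isPGroup' hgP
      hg hx hx1 hgx (hDP hd))
  have hPD : (P : Subgroup G) = sigmaCommutator σ G := by
    refine le_antisymm (fun x hx => ?_) hDP
    obtain ⟨y, hy, rfl⟩ := exists_commutator_eq (powerNormalizer_le_normalizer _ hgP) hfix hx
    exact commutator_mem_sigmaCommutator (hσ.areSeparated hpi hq hqi)
      (isPElement_of_mem P.isPGroup' hy) hg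
  exact ⟨hPD ▸ P.not_dvd_index, g, hgH, hPD ▸ hfix⟩

theorem commute_of_fixedPointFree_of_isPElement [Finite G] (hσ : IsPrimePartition σ)
    (hp : p.Prime) (hDp : IsPGroup p (sigmaCommutator σ G))
    (hindex : ¬ p ∣ (sigmaCommutator σ G).index) {g : G}
    (hg : g ∈ powerNormalizer (piGenerated (σ i) (⊤ : Subgroup G) ⊔ sigmaCommutator σ G))
    (hfix : ∀ x ∈ sigmaCommutator σ G, Commute g x → x = 1) {r : ℕ} (hr : r ∈ σ i) {x z : G}
    (hx : x ∈ sigmaCommutator σ G) (hz : IsPElement r z) : Commute x z := by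
  have hgD := powerNormalizer_anti le_sup_right hg
  rcases eq_or_ne p r with rfl | hpr
  · exact commute_of_fixedPointFree hgD hfix hx (hz.mem_of_not_dvd_index hp hindex)
  obtain ⟨y, hy, rfl⟩ := exists_commutator_eq (powerNormalizer_le_normalizer _ hgD) hfix hx
  have hzH : z ∈ piGenerated (σ i) (⊤ : Subgroup G) ⊔ sigmaCommutator σ G :=
    Subgroup.mem_sup_left (mem_piGenerated (hσ.prime hr) hr (Subgroup.mem_top z) hz)
  have hxH : ⁅y, g⁆ ∈ powerNormalizer (piGenerated (σ i) ⊤ ⊔ sigmaCommutator σ G) :=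
    commutator_mem_right (normalizer_le_normalizer_powerNormalizer _
      (Subgroup.le_normalizer (Subgroup.mem_sup_right hy))) hg
  refine commute_of_commutator_mem hp (hσ.prime hr) hpr hDp hz.isPGroup_zpowers ?_ ?_
  · exact commutator_mem_left (Subgroup.le_normalizer_of_normal (Subgroup.mem_top z)) hx
  · exact commutator_mem_right (mem_powerNormalizer.1 hxH z hzH) (Subgroup.mem_zpowers z)

end LocalResidual

/-! ### Structure of the residual -/

section ResidualStructure

variable {I : Type v} {σ : I → Set ℕ} {G : Type*} [Group G] {i : I} {p : ℕ}

/-- The properties of the `σ`-nilpotent residual `D` from which the theorem follows in both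
directions: `D` is an abelian Hall subgroup, all its subgroups are normal in `G`, and the
`σ i`-elements of `G` centralise the `σ i`-elements of `D`. The residual appears as
`sigmaCommutator σ G`. -/
structure ResidualConditions (σ : I → Set ℕ) (G : Type*) [Group G] : Prop where
  comm : ∀ x ∈ sigmaCommutator σ G, ∀ y ∈ sigmaCommutator σ G, Commute x y
  hall : ∀ p : ℕ, p.Prime → p ∣ Nat.card (sigmaCommutator σ G) →
    ¬ p ∣ (sigmaCommutator σ G).index
  normal_of_le : ∀ K ≤ sigmaCommutator σ G, K.Normal
  commute : ∀ (i : I) (p r : ℕ), p ∈ σ i → r ∈ σ i → ∀ x ∈ sigmaCommutator σ G, IsPElement p x →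
    ∀ z : G, IsPElement r z → Commute x z

theorem NormalisesSections.isPiGroup_piGenerated [Finite G]
    (hG : IsSigmaSoluble σ G) (h : NormalisesSections σ G) (π : Set ℕ) :
    IsPiGroup π (piGenerated π (sigmaCommutator σ G)) :=
  SigmaTheory.isPiGroup_piGenerated fun p q hp hq hpπ hqπ _ hx _ hy hxp hyq =>
    h.commute_of_isPElement hG hp hq (by rintro rfl; exact hqπ hpπ) hx hy hxp hyq

theorem isPGroup_sigmaCommutator_quotient [Finite G] (p : ℕ) :
    IsPGroup p (sigmaCommutator σ (G ⧸ piGenerated {p}ᶜ (sigmaCommutator σ G))) := by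
  refine isPGroup_of_isPiGroup (isPiGroup_coe_iff.2 ?_)
  rw [← map_sigmaCommutator (QuotientGroup.mk'_surjective _)]
  intro q hq hqp y hy hyq
  obtain ⟨x, hxq, hxy⟩ := (isPElement_coe_iff (x := ⟨y, hy⟩).1 hyq).exists_lift hq
    ((QuotientGroup.mk' _).subgroupMap_surjective (sigmaCommutator σ G))
  replace hxy : QuotientGroup.mk' _ (x : G) = y := congrArg Subtype.val hxy
  rw [← hxy, QuotientGroup.mk'_apply, QuotientGroup.eq_one_iff]
  exact mem_piGenerated hq hqp x.2 (isPElement_coe_iff.2 hxq)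

theorem NormalisesSections.sigmaCommutator_quotient_ne_bot [Finite G]
    (hG : IsSigmaSoluble σ G) (h : NormalisesSections σ G) (hp : p.Prime)
    (hd : p ∣ Nat.card (sigmaCommutator σ G)) :
    sigmaCommutator σ (G ⧸ piGenerated {p}ᶜ (sigmaCommutator σ G)) ≠ ⊥ := by
  rw [Ne, sigmaCommutator_quotient_eq_bot_iff]
  exact fun hle => h.isPiGroup_piGenerated hG {p}ᶜ p hp (hd.trans (Subgroup.card_dvd_of_le hle))
    (Set.mem_singleton p)

theorem NormalisesSections.not_dvd_index [Finite G]
    (hσ : IsPrimePartition σ) (hG : IsSigmaSoluble σ G) (h : NormalisesSections σ G)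
    (hp : p.Prime) (hd : p ∣ Nat.card (sigmaCommutator σ G)) :
    ¬ p ∣ (sigmaCommutator σ G).index := by
  obtain ⟨i, hi⟩ := hσ.exists_mem hp
  have hf := QuotientGroup.mk'_surjective (piGenerated {p}ᶜ (sigmaCommutator σ G))
  have hindex := ((h.of_surjective hf).exists_fixedPointFree hσ hp hi
    (h.sigmaCommutator_quotient_ne_bot hG hp hd) (isPGroup_sigmaCommutator_quotient p)).1
  rwa [← map_sigmaCommutator hf, Subgroup.index_map_eq _ hf
    (by rw [QuotientGroup.ker_mk']; exact piGenerated_le_self)] at hindex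

theorem NormalisesSections.odd_card_sigmaCommutator [Finite G]
    (hσ : IsPrimePartition σ) (hG : IsSigmaSoluble σ G) (h : NormalisesSections σ G) :
    Odd (Nat.card (sigmaCommutator σ G)) := by
  rw [← Nat.not_even_iff_odd, even_iff_two_dvd]
  intro hd
  obtain ⟨i, hi⟩ := hσ.exists_mem Nat.prime_two
  have hf := QuotientGroup.mk'_surjective (piGenerated {2}ᶜ (sigmaCommutator σ G))
  have hD := h.sigmaCommutator_quotient_ne_bot hG Nat.prime_two hd
  have hD2 := isPGroup_sigmaCommutator_quotient (σ := σ) (G := G) 2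
  obtain ⟨-, g, hg, hfix⟩ :=
    (h.of_surjective hf).exists_fixedPointFree hσ Nat.prime_two hi hD hD2
  have := Fact.mk Nat.prime_two
  have := (Subgroup.nontrivial_iff_ne_bot _).2 hD
  obtain ⟨n, hn0, hn⟩ := hD2.nontrivial_iff_card.1 this
  exact not_two_dvd_card_of_fixedPointFree (powerNormalizer_anti le_sup_right hg) hfix
    (hn ▸ dvd_pow_self 2 hn0.ne')

theorem NormalisesSections.commute_of_mem_class [Finite G]
    (hσ : IsPrimePartition σ) (hG : IsSigmaSoluble σ G) (h : NormalisesSections σ G)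
    (hpi : p ∈ σ i) {r : ℕ} (hri : r ∈ σ i) {x z : G} (hx : x ∈ sigmaCommutator σ G)
    (hxp : IsPElement p x) (hz : IsPElement r z) : Commute x z := by
  have hp := hσ.prime hpi
  by_cases hd : p ∣ Nat.card (sigmaCommutator σ G)
  · have hf := QuotientGroup.mk'_surjective (piGenerated {p}ᶜ (sigmaCommutator σ G))
    have hDp := isPGroup_sigmaCommutator_quotient (σ := σ) (G := G) p
    obtain ⟨hindex, g, hg, hfix⟩ := (h.of_surjective hf).exists_fixedPointFree hσ hp hpi
      (h.sigmaCommutator_quotient_ne_bot hG hp hd) hDp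
    have hcomm := commute_of_fixedPointFree_of_isPElement hσ hp hDp hindex hg hfix hri
      (map_sigmaCommutator (σ := σ) hf ▸ Subgroup.mem_map_of_mem _ hx)
      (hz.map (QuotientGroup.mk' _))
    rw [← commutatorElement_eq_one_iff_commute, ← map_commutatorElement, QuotientGroup.mk'_apply,
      QuotientGroup.eq_one_iff] at hcomm
    have hmem : ⁅x, z⁆ ∈ piGenerated {p} (sigmaCommutator σ G) :=
      commutator_mem_left (Subgroup.le_normalizer_of_normal (Subgroup.mem_top z))
        (mem_piGenerated hp (Set.mem_singleton p) hx hxp)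
    have hdisj := Subgroup.disjoint_of_coprime_natCard <| IsPiNumber.coprime
      (h.isPiGroup_piGenerated hG {p}) fun q hq hd => h.isPiGroup_piGenerated hG {p}ᶜ q hq hd
    exact commutatorElement_eq_one_iff_commute.1 (Subgroup.mem_bot.1 (hdisj.le_bot ⟨hmem, hcomm⟩))
  · have hx1 := (isPElement_coe_iff (x := ⟨x, hx⟩).1 hxp).eq_one_of_not_dvd hp pow_card_eq_one' hd
    obtain rfl : x = 1 := congrArg Subtype.val hx1
    exact Commute.one_left z

theorem NormalisesSections.commute_of_mem_sigmaCommutator [Finite G]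
    (hσ : IsPrimePartition σ) (hG : IsSigmaSoluble σ G) (h : NormalisesSections σ G) {x y : G}
    (hx : x ∈ sigmaCommutator σ G) (hy : y ∈ sigmaCommutator σ G) : Commute x y := by
  refine commute_of_forall_isPElement (fun p q hp hq x hx y hy hxp hyq => ?_) hx hy
  rcases eq_or_ne p q with rfl | hpq
  · obtain ⟨i, hi⟩ := hσ.exists_mem hp
    exact h.commute_of_mem_class hσ hG hi hi hx hxp hyq
  · exact h.commute_of_isPElement hG hp hq hpq hx hy hxp hyq

theorem NormalisesSections.normal_of_le_sigmaCommutator [Finite G]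
    (hσ : IsPrimePartition σ) (hG : IsSigmaSoluble σ G) (h : NormalisesSections σ G)
    {K : Subgroup G} (hK : K ≤ sigmaCommutator σ G) : K.Normal := by
  have hconj : ∀ q : ℕ, q.Prime → ∀ g : G, IsPElement q g → ∀ x ∈ K, g * x * g⁻¹ ∈ K := by
    intro q hq g hg
    suffices hle : K ≤ K.comap (MulAut.conj g).toMonoidHom from hle
    refine le_of_forall_isPElement_mem fun p hp x hx hxp => ?_
    suffices hz : g * x * g⁻¹ ∈ Subgroup.zpowers x from Subgroup.zpowers_le.2 hx hz
    obtain ⟨i, hi⟩ := hσ.exists_mem hp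
    by_cases hqi : q ∈ σ i
    · rw [(h.commute_of_mem_class hσ hG hi hqi (hK hx) hxp hg).symm.mul_inv_cancel]
      exact Subgroup.mem_zpowers x
    · exact conj_mem_zpowers_of_mem_powerNormalizer
        (h.mem_powerNormalizer (h.isPiGroup_piGenerated hG (σ i)) hq hqi hg)
        (mem_piGenerated hp hi (hK hx) hxp)
  rw [← Subgroup.normalizer_eq_top_iff, eq_top_iff]
  refine le_of_forall_isPElement_mem fun q hq g _ hg => ?_
  exact Subgroup.le_normalizer_iff.2 (fun b hb => hconj q hq b
    (isPElement_of_mem hg.isPGroup_zpowers hb)) (Subgroup.mem_zpowers g)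

theorem NormalisesSections.residualConditions [Finite G]
    (hσ : IsPrimePartition σ) (hG : IsSigmaSoluble σ G) (h : NormalisesSections σ G) :
    ResidualConditions σ G where
  comm _ hx _ hy := h.commute_of_mem_sigmaCommutator hσ hG hx hy
  hall _ hp hd := h.not_dvd_index hσ hG hp hd
  normal_of_le _ hK := h.normal_of_le_sigmaCommutator hσ hG hK
  commute _ _ _ hp hr _ hx hxp _ hz := h.commute_of_mem_class hσ hG hp hr hx hxp hz

end ResidualStructure

section HallSubgroups

variable {I : Type v} {σ : I → Set ℕ} {G : Type*} [Group G] {i : I} {π : Set ℕ}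

theorem IsHallPi.le_of_normal {O H : Subgroup G} (h : IsHallPi π H) [O.Normal]
    (hO : IsPiGroup π O) : O ≤ H := by
  have hindex : H.relIndex O = H.relIndex (O ⊔ H) :=
    relIndex_eq_of_subset_mul le_sup_left (Subgroup.normal_mul O H).subset
  rw [← Subgroup.relIndex_eq_one]
  refine (Nat.coprime_self _).1 (IsPiNumber.coprime
    (IsPiNumber.of_dvd hO (Subgroup.relIndex_dvd_card _ _)) fun p hp hd => h.2 p hp ?_)
  exact hd.trans (hindex ▸ Subgroup.relIndex_dvd_index_of_le le_sup_right)

theorem IsHallPi.sup_sigmaCommutator [Finite G] (hσ : IsPrimePartition σ) {H : Subgroup G}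
    (h : IsHallPi (σ i) H) :
    H ⊔ sigmaCommutator σ G = piGenerated (σ i) (⊤ : Subgroup G) ⊔ sigmaCommutator σ G := by
  have hle : H ⊔ sigmaCommutator σ G ≤ piGenerated (σ i) (⊤ : Subgroup G) ⊔ sigmaCommutator σ G :=
    sup_le_sup_right (IsPiGroup.le_piGenerated h.1 le_top) _
  refine le_antisymm hle (Subgroup.relIndex_eq_one.1 ((Nat.coprime_self _).1 (IsPiNumber.coprime
    ((isPiNumber_relIndex_piGenerated_sup (G := G) hσ i).of_dvd
      (Subgroup.relIndex_dvd_of_le_left _ le_sup_right)) fun p hp hd => h.2 p hp ?_)))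
  exact hd.trans ((Subgroup.relIndex_dvd_index_of_le hle).trans
    (Subgroup.index_dvd_of_le le_sup_left))

theorem permutesHalls_of_sigmaCommutator_le [Finite G] (hσ : IsPrimePartition σ) {V : Subgroup G}
    (hV : sigmaCommutator σ G ≤ V) : PermutesHalls σ V := by
  intro i H hH
  have hn : (H ⊔ sigmaCommutator σ G).Normal := by
    rw [hH.sup_sigmaCommutator hσ]
    infer_instance
  refine permutes_of_subset ?_
  rintro _ ⟨h, hh, v, hv, rfl⟩
  have hconj : v⁻¹ * h * v⁻¹⁻¹ ∈ ((sigmaCommutator σ G ⊔ H : Subgroup G) : Set G) :=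
    sup_comm H _ ▸ hn.conj_mem h (Subgroup.mem_sup_left hh) v⁻¹
  rw [Subgroup.normal_mul] at hconj
  obtain ⟨d, hd, k, hk, hdk : d * k = _⟩ := hconj
  refine ⟨v * d, V.mul_mem hv (hV hd), k, hk, ?_⟩
  change v * d * k = h * v
  rw [mul_assoc, hdk]
  group

theorem map_piCore_eq [Finite G] {D : Subgroup G} (hD : ∀ x ∈ D, ∀ y ∈ D, Commute x y) :
    (piCore π D).map D.subtype = piGenerated π D := by
  apply le_antisymm
  · rw [Subgroup.map_le_iff_le_comap]
    refine sSup_le ?_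
    rintro N ⟨-, hN⟩
    rw [← Subgroup.map_le_iff_le_comap]
    exact IsPiGroup.le_piGenerated (IsPiNumber.of_dvd hN (Subgroup.card_map_dvd N D.subtype))
      (Subgroup.map_subtype_le N)
  · refine piGenerated_le fun p hp hpπ x hx hxp => ⟨⟨x, hx⟩, ?_, rfl⟩
    suffices hmem : Subgroup.zpowers (⟨x, hx⟩ : D) ∈
        {N : Subgroup D | N.Normal ∧ IsPiGroup π N} from
      le_sSup hmem (Subgroup.mem_zpowers _)
    refine ⟨⟨fun y hy g => ?_⟩, isPiGroup_coe_iff.2 fun q hq hqπ y hy hyq => ?_⟩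
    · have hgy : Commute g y := Subtype.ext (hD g g.2 y y.2)
      rwa [hgy.mul_inv_cancel]
    · have hxp : IsPElement p (⟨x, hx⟩ : D) := isPElement_coe_iff.1 hxp
      exact hyq.eq_one_of_ne hq hp (by rintro rfl; exact hqπ hpπ)
        (isPElement_of_mem hxp.isPGroup_zpowers hy)

theorem ResidualConditions.isPiGroup_piGenerated [Finite G] (h : ResidualConditions σ G)
    (π : Set ℕ) : IsPiGroup π (piGenerated π (sigmaCommutator σ G)) :=
  SigmaTheory.isPiGroup_piGenerated fun _ _ _ _ _ _ x hx y hy _ _ => h.comm x hx y hy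

theorem ResidualConditions.coprime (h : ResidualConditions σ G) :
    Nat.Coprime (Nat.card (sigmaCommutator σ G)) (sigmaCommutator σ G).index :=
  Nat.coprime_of_dvd h.hall

theorem ResidualConditions.coprime_piGenerated [Finite G] (h : ResidualConditions σ G)
    (π : Set ℕ) : Nat.Coprime (Nat.card (piGenerated π (sigmaCommutator σ G)))
      (piGenerated π (sigmaCommutator σ G)).index := by
  rw [← Subgroup.relIndex_mul_index piGenerated_le_self]
  refine Nat.Coprime.mul_right ?_ (h.coprime.coprime_dvd_left
    (Subgroup.card_dvd_of_le piGenerated_le_self))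
  have hrel : IsPiNumber πᶜ ((piGenerated π (sigmaCommutator σ G)).relIndex
      (sigmaCommutator σ G)) :=
    isPiNumber_relIndex fun p hp hpπ x hx hxp =>
      mem_piGenerated hp (Set.notMem_compl_iff.1 hpπ) hx hxp
  exact IsPiNumber.coprime (h.isPiGroup_piGenerated π) hrel

theorem ResidualConditions.commute_of_mem_hall [Finite G] (h : ResidualConditions σ G)
    {H : Subgroup G} (hH : IsHallPi (σ i) H) {x y : G}
    (hx : x ∈ piGenerated (σ i) (sigmaCommutator σ G)) (hy : y ∈ H) : Commute x y :=
  commute_of_mem_piGenerated (fun p r _ _ hpi hri x hx y _ hxp hyr =>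
    h.commute i p r hpi hri x hx hxp y hyr) hx (IsPiGroup.le_piGenerated hH.1 le_rfl hy)

theorem ResidualConditions.hasNormalComplementIn [Finite G] (h : ResidualConditions σ G)
    {H : Subgroup G} (hH : IsHallPi (σ i) H) :
    HasNormalComplementIn ((piCore (σ i) (sigmaCommutator σ G)).map
      (sigmaCommutator σ G).subtype) H := by
  rw [map_piCore_eq h.comm]
  have := h.normal_of_le _ (piGenerated_le_self (π := σ i))
  have hOH := hH.le_of_normal (h.isPiGroup_piGenerated (σ i))
  refine ⟨hOH, ?_⟩
  have hcop : Nat.Coprime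
      (Nat.card ((piGenerated (σ i) (sigmaCommutator σ G)).subgroupOf H))
      ((piGenerated (σ i) (sigmaCommutator σ G)).subgroupOf H).index := by
    rw [Nat.card_congr (Subgroup.subgroupOfEquivOfLe hOH).toEquiv]
    exact (h.coprime_piGenerated (σ i)).coprime_dvd_right (Subgroup.relIndex_dvd_index_of_le hOH)
  obtain ⟨S, hS⟩ := Subgroup.exists_left_complement'_of_coprime hcop
  refine ⟨S, ?_, hS⟩
  rw [← Subgroup.normalizer_eq_top_iff, eq_top_iff, ← hS.sup_eq_top]
  refine sup_le Subgroup.le_normalizer (Subgroup.le_normalizer_iff.2 fun o ho s hs => ?_)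
  have hcomm : Commute o s := Subtype.ext (h.commute_of_mem_hall hH ho s.2)
  rwa [hcomm.mul_inv_cancel]

end HallSubgroups

section Direct

variable {I : Type v} {σ : I → Set ℕ} {G : Type*} [Group G]

theorem exists_retraction {D M : Subgroup G} [D.Normal] (h : Subgroup.IsComplement' D M) :
    ∃ φ : G →* M, Function.Surjective φ ∧ φ.ker = D := by
  refine ⟨h.symm.QuotientMulEquiv.toMonoidHom.comp (QuotientGroup.mk' D),
    h.symm.QuotientMulEquiv.surjective.comp (QuotientGroup.mk'_surjective D), ?_⟩
  exact (MonoidHom.ker_mulEquiv_comp (QuotientGroup.mk' D) h.symm.QuotientMulEquiv).trans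
    (QuotientGroup.ker_mk' D)

theorem mem_of_isComplement' {G : Type u} [Group G] [Finite G] {τ : SubgroupSystem.{u}}
    (hτ : IsSubgroupFunctor σ τ) {D M : Subgroup G} [D.Normal] (hM : Subgroup.IsComplement' D M)
    (hGfull : IsSigmaFull σ G) (hMfull : IsSigmaFull σ M) (h : ∀ V : Subgroup G, D ≤ V → V ∈ τ G)
    (U : Subgroup M) : U ∈ τ M := by
  obtain ⟨φ, hφ, hker⟩ := exists_retraction hM
  rw [← Subgroup.map_comap_eq_self_of_surjective hφ U]
  exact hτ.map_mem G M hGfull hMfull φ hφ _ (h _ (hker ▸ φ.ker_le_comap U))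

theorem isSigmaNilpotent_of_isComplement' {G : Type u} [Group G] [Finite G]
    (hσ : IsPrimePartition σ) {M : Subgroup G}
    (hM : Subgroup.IsComplement' (sigmaCommutator σ G) M) : IsSigmaNilpotent σ M := by
  rw [isSigmaNilpotent_iff hσ, eq_bot_iff]
  refine sigmaCommutator_le fun p q hpq x y hx hy => ?_
  have hmem : (⁅(x : G), (y : G)⁆ : G) ∈ sigmaCommutator σ G :=
    commutator_mem_sigmaCommutator hpq (isPElement_coe_iff.2 hx) (isPElement_coe_iff.2 hy)
  exact Subtype.ext (Subgroup.mem_bot.1 (hM.disjoint.le_bot ⟨hmem, (⁅x, y⁆ : M).2⟩))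

theorem isPowerAutomorphism_conjNormal [Finite G] {D : Subgroup G} [D.Normal]
    (h : ∀ K ≤ D, K.Normal) (g : G) : IsPowerAutomorphism (MulAut.conjNormal g : MulAut D) := by
  intro K
  refine Subgroup.eq_of_le_of_card_ge ?_
    (Subgroup.card_map_of_injective (MulAut.conjNormal g : MulAut D).injective).ge
  rintro _ ⟨x, hx, rfl⟩
  obtain ⟨y, hy, hyx⟩ :=
    (h _ (Subgroup.map_subtype_le K)).conj_mem (x : G) (Subgroup.mem_map_of_mem _ hx) g
  have hxy : y = (MulAut.conjNormal g : MulAut D) x :=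
    Subtype.ext (hyx.trans (MulAut.conjNormal_apply g x).symm)
  exact hxy ▸ hy

theorem exists_structureConditions {G : Type u} [Group G] [Finite G] (hσ : IsPrimePartition σ)
    {τ : SubgroupSystem.{u}} (hτ : IsSigmaSpecial σ τ) (hG : IsSigmaSoluble σ G)
    (h : ∀ A : Subgroup G, IsSigmaSubnormal σ A → A ∈ τ G) :
    IsPSigmaTGroup σ G ∧ ∃ M : Subgroup G, StructureConditions σ τ (sigmaCommutator σ G) M := by
  have hS := hG.hasSigmaSeries
  have hF := hS.isSigmaFull hσ
  have hP : ∀ A : Subgroup G, IsSigmaSubnormal σ A → PermutesHalls σ A := fun A hA =>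
    (hτ.permutable G hF A hA (h A hA)).permutesHalls
  have hN := normalisesSections_of_permutesHalls hσ hS hP
  have hR := hN.residualConditions hσ hG
  have hτD : ∀ V : Subgroup G, sigmaCommutator σ G ≤ V → V ∈ τ G := fun V hV =>
    h V ((permutesHalls_of_sigmaCommutator_le hσ hV).isSigmaSubnormal hσ hS)
  refine ⟨isPSigmaTGroup_of_permutesHalls hσ hS hP, ?_⟩
  obtain ⟨M, hM⟩ := Subgroup.exists_right_complement'_of_coprime hR.coprime
  exact ⟨M,
    { semidirect := ⟨inferInstance, hM⟩
      abelian := hR.comm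
      hall := hR.coprime
      odd := hN.odd_card_sigmaCommutator hσ hG
      nilpotent := isSigmaNilpotent_of_isComplement' hσ hM
      mem := mem_of_isComplement' hτ.toIsSubgroupFunctor hM hF
        ((hS.subgroup M).isSigmaFull hσ) hτD
      power := isPowerAutomorphism_conjNormal hR.normal_of_le
      complement := fun i =>
        (hS.exists_isHallPi hσ i).imp fun _ hH => ⟨hH, hR.hasNormalComplementIn hH⟩ }⟩

end Direct

/-! ### The converse -/

section SubnormalPermutability

variable {I : Type v} {σ : I → Set ℕ} {G G' : Type*} [Group G] [Group G'] {A B : Subgroup G}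
  {p q : ℕ}

theorem ResidualConditions.of_surjective [Finite G] (hσ : IsPrimePartition σ)
    (h : ResidualConditions σ G) {f : G →* G'} (hf : Function.Surjective f) :
    ResidualConditions σ G' := by
  have hmap : (sigmaCommutator σ G).map f = sigmaCommutator σ G' := map_sigmaCommutator hf
  refine ⟨?_, ?_, ?_, ?_⟩ <;> rw [← hmap]
  · rintro _ ⟨x, hx, rfl⟩ _ ⟨y, hy, rfl⟩
    exact (h.comm x hx y hy).map f
  · intro p hp hd hi
    exact h.hall p hp (hd.trans (Subgroup.card_map_dvd _ f))
      (hi.trans (Subgroup.index_map_dvd _ hf))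
  · intro K hK
    have hKmap : (K.comap f ⊓ sigmaCommutator σ G).map f = K := by
      refine le_antisymm (Subgroup.map_le_iff_le_comap.2 inf_le_left) fun y hy => ?_
      obtain ⟨x, hx, rfl⟩ := hK hy
      exact ⟨x, ⟨hy, hx⟩, rfl⟩
    exact hKmap ▸ (h.normal_of_le _ inf_le_right).map f hf
  · intro i p r hp hr y hy hyp z hz
    obtain ⟨x, hxp, hxy⟩ := (isPElement_coe_iff (x := ⟨y, hy⟩).1 hyp).exists_lift (hσ.prime hp)
      (f.subgroupMap_surjective _)
    obtain ⟨w, hw, rfl⟩ := hz.exists_lift (hσ.prime hr) hf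
    replace hxy : f x = y := congrArg Subtype.val hxy
    exact hxy ▸ (h.commute i p r hp hr x x.2 (isPElement_coe_iff.2 hxp) w hw).map f

theorem ResidualConditions.powerNormalizer_eq_top (h : ResidualConditions σ G) :
    powerNormalizer (sigmaCommutator σ G) = ⊤ := by
  refine eq_top_iff.2 fun g _ => mem_powerNormalizer.2 fun x hx => ?_
  have := h.normal_of_le _ (Subgroup.zpowers_le.2 hx)
  exact Subgroup.le_normalizer_of_normal (Subgroup.mem_top g)

/-- A subgroup that `E` normalises and that contains `a` contains `E = ⁅E, a⁆`, so `E` descends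
through the subnormal chain. -/
theorem le_of_forall_exists_commutator_eq [Finite G] {E : Subgroup G}
    (h : Relation.ReflTransGen (SigmaSubnormalStep σ) A B) (hEB : E ≤ B)
    (hpq : AreSeparated σ p q) (hE : IsPGroup p E) {a : G} (ha : a ∈ A) (haq : IsPElement q a)
    (hEa : ∀ e ∈ E, ∃ c ∈ E, ⁅c, a⁆ = e) : E ≤ A := by
  induction h using Relation.ReflTransGen.head_induction_on with
  | refl => exact hEB
  | @head A A₁ hstep _ ih =>
    obtain ⟨hle, hstep⟩ := sigmaSubnormalStep_iff.1 hstep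
    have hEA := ih (hle ha)
    have hmem : ∀ C : Subgroup G, A₁ ≤ Subgroup.normalizer (C : Set G) → a ∈ C → E ≤ C := by
      intro C hC haC e he
      obtain ⟨c, hc, rfl⟩ := hEa e he
      exact commutator_mem_right (hC (hEA hc)) haC
    rcases hstep with hn | ⟨j, C, hCA, hC, hj⟩
    · exact hmem A hn ha
    · by_cases hpj : p ∈ σ j
      · exact (hmem C hC
          (haq.mem_of_isPiNumber_relIndex hC hj hpq.2.1 (hpq.2.2 j hpj) (hle ha))).trans hCA
      · exact fun e he => hCA
          ((isPElement_of_mem hE he).mem_of_isPiNumber_relIndex hC hj hpq.1 hpj (hEA he))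

theorem ResidualConditions.commute_of_areSeparated_of_inf_eq_bot [Finite G]
    (hσ : IsPrimePartition σ) (h : ResidualConditions σ G) (hA : IsSigmaSubnormal σ A)
    (hAD : A ⊓ sigmaCommutator σ G = ⊥) (hpq : AreSeparated σ p q) {x a : G}
    (hx : x ∈ sigmaCommutator σ G) (hxp : IsPElement p x) (ha : a ∈ A) (haq : IsPElement q a) :
    Commute a x := by
  by_contra hax
  have hpow : a ∈ powerNormalizer (Subgroup.zpowers x) :=
    powerNormalizer_anti (Subgroup.zpowers_le.2 hx) (h.powerNormalizer_eq_top ▸ Subgroup.mem_top a)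
  have hfix : ∀ w ∈ Subgroup.zpowers x, Commute a w → w = 1 := by
    intro w hw haw
    by_contra hw1
    exact hax (commute_of_mem_powerNormalizer hpq.1 hpq.2.1 (hpq.ne hσ) hxp.isPGroup_zpowers hpow
      haq hw hw1 haw (Subgroup.mem_zpowers x))
  have hle : Subgroup.zpowers x ≤ A :=
    le_of_forall_exists_commutator_eq hA le_top hpq hxp.isPGroup_zpowers ha haq fun _ he =>
      exists_commutator_eq (powerNormalizer_le_normalizer _ hpow) hfix he
  have hx1 : x ∈ A ⊓ sigmaCommutator σ G := ⟨hle (Subgroup.mem_zpowers x), hx⟩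
  rw [hAD, Subgroup.mem_bot] at hx1
  exact hax (hx1 ▸ Commute.one_right a)

theorem ResidualConditions.commute_of_inf_eq_bot [Finite G] (hσ : IsPrimePartition σ)
    (h : ResidualConditions σ G) (hA : IsSigmaSubnormal σ A)
    (hAD : A ⊓ sigmaCommutator σ G = ⊥) {a d : G} (ha : a ∈ A) (hd : d ∈ sigmaCommutator σ G) :
    Commute a d := by
  refine commute_of_forall_isPElement (fun q p hq hp a ha x hx haq hxp => ?_) ha hd
  rcases exists_common_or_areSeparated σ hp hq with ⟨i, hpi, hqi⟩ | hpq
  · exact (h.commute i p q hpi hqi x hx hxp a haq).symm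
  · exact h.commute_of_areSeparated_of_inf_eq_bot hσ hA hAD hpq hx hxp ha haq

theorem ResidualConditions.not_dvd_card [Finite G] (h : ResidualConditions σ G)
    (hAD : A ⊓ sigmaCommutator σ G = ⊥) (hp : p.Prime) {x : G} (hx : x ∈ A)
    (hxp : IsPElement p x) (hx1 : x ≠ 1) : ¬ p ∣ Nat.card (sigmaCommutator σ G) := by
  intro hd
  have hxAD : x ∈ A ⊓ sigmaCommutator σ G := ⟨hx, hxp.mem_of_not_dvd_index hp (h.hall p hp hd)⟩
  rw [hAD, Subgroup.mem_bot] at hxAD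
  exact hx1 hxAD

theorem ResidualConditions.commute_of_areSeparated [Finite G] (hσ : IsPrimePartition σ)
    (h : ResidualConditions σ G) (hA : IsSigmaSubnormal σ A) (hAD : A ⊓ sigmaCommutator σ G = ⊥)
    (hpq : AreSeparated σ p q) {x g : G} (hx : x ∈ A) (hxp : IsPElement p x)
    (hg : IsPElement q g) : Commute g x := by
  by_cases hx1 : x = 1
  · exact hx1 ▸ Commute.one_right g
  have hd : ⁅g, x⁆ ∈ sigmaCommutator σ G := commutator_mem_sigmaCommutator hpq.symm hg hxp
  have hdp : IsPElement p ⁅g, x⁆ :=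
    hxp.commutator_right (h.commute_of_inf_eq_bot hσ hA hAD hx hd).symm
  have hd1 : (⟨⁅g, x⁆, hd⟩ : sigmaCommutator σ G) = 1 :=
    (isPElement_coe_iff.1 hdp).eq_one_of_not_dvd hpq.1 pow_card_eq_one'
      (h.not_dvd_card hAD hpq.1 hx hxp hx1)
  exact commutatorElement_eq_one_iff_commute.1 (congrArg Subtype.val hd1)

theorem ResidualConditions.mem_of_mem_sup [Finite G] (hσ : IsPrimePartition σ)
    (h : ResidualConditions σ G) (hA : IsSigmaSubnormal σ A) (hAD : A ⊓ sigmaCommutator σ G = ⊥)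
    (hp : p.Prime) {x : G} (hx : x ∈ A) (hxp : IsPElement p x) {M : Subgroup G}
    (hxM : x ∈ sigmaCommutator σ G ⊔ M) : x ∈ M := by
  by_cases hx1 : x = 1
  · exact hx1 ▸ M.one_mem
  rw [← SetLike.mem_coe, Subgroup.normal_mul] at hxM
  obtain ⟨d, hd, m, hm, hdm : d * m = x⟩ := hxM
  have hdx : Commute d⁻¹ x := (h.commute_of_inf_eq_bot hσ hA hAD hx hd).symm.inv_left
  have hd1 : d ^ Nat.card (sigmaCommutator σ G) = 1 :=
    congrArg Subtype.val (pow_card_eq_one' (x := (⟨d, hd⟩ : sigmaCommutator σ G)))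
  have hmx : m ^ Nat.card (sigmaCommutator σ G) = x ^ Nat.card (sigmaCommutator σ G) := by
    rw [eq_inv_mul_of_mul_eq hdm, hdx.mul_pow, inv_pow, hd1, inv_one, one_mul]
  refine hxp.mem_of_zpow_mem hp (m := Nat.card (sigmaCommutator σ G))
    (Int.natCast_dvd_natCast.not.2 (h.not_dvd_card hAD hp hx hxp hx1)) ?_
  rw [zpow_natCast, ← hmx]
  exact M.pow_mem hm _

theorem ResidualConditions.permutesHalls_of_inf_eq_bot [Finite G] (hσ : IsPrimePartition σ)
    (h : ResidualConditions σ G) (hA : IsSigmaSubnormal σ A)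
    (hAD : A ⊓ sigmaCommutator σ G = ⊥) : PermutesHalls σ A := by
  intro j H hH
  have hsup : piGenerated (σ j) A ⊔ piGenerated (σ j)ᶜ A = A := by
    rw [← piGenerated_union, Set.union_compl_self]
    exact piGenerated_le_self.antisymm
      (IsPiGroup.le_piGenerated (fun p _ _ => Set.mem_univ p) le_rfl)
  rw [← hsup]
  refine Permutes.sup_left (permutes_of_le ?_) (permutes_of_le_normalizer ?_)
  · refine piGenerated_le fun p hp hpj x hx hxp => h.mem_of_mem_sup hσ hA hAD hp hx hxp ?_
    rw [sup_comm, hH.sup_sigmaCommutator hσ]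
    exact Subgroup.mem_sup_left (mem_piGenerated hp hpj (Subgroup.mem_top x) hxp)
  · refine Subgroup.le_normalizer_iff.2 fun b hb x hx => ?_
    have hbx : Commute x b := commute_of_mem_piGenerated (fun p r hp _ hpj hrj x hx y _ hxp hyr =>
      (h.commute_of_areSeparated hσ hA hAD (hσ.areSeparated hrj hp hpj).symm hx hxp hyr).symm)
      hx (IsPiGroup.le_piGenerated hH.1 le_rfl hb)
    rwa [hbx.symm.mul_inv_cancel]

theorem map_inf_map_eq_bot {D : Subgroup G} {f : G →* G'} (hker : f.ker = A ⊓ D) :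
    A.map f ⊓ D.map f = ⊥ := by
  rw [eq_bot_iff]
  rintro _ ⟨⟨a, ha, rfl⟩, haD⟩
  have haD : a ∈ D := by
    rwa [← Subgroup.comap_map_eq_self (hker.trans_le inf_le_right)]
  exact MonoidHom.mem_ker.1 (hker ▸ ⟨ha, haD⟩)

theorem IsHallPi.map {π : Set ℕ} {H : Subgroup G} (h : IsHallPi π H) {f : G →* G'}
    (hf : Function.Surjective f) : IsHallPi π (H.map f) :=
  ⟨IsPiNumber.of_dvd h.1 (Subgroup.card_map_dvd _ f),
    fun p hp hd => h.2 p hp (hd.trans (Subgroup.index_map_dvd _ hf))⟩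

theorem Permutes.of_map {f : G →* G'} (hker : f.ker ≤ A) (h : Permutes (A.map f) (B.map f)) :
    Permutes A B := by
  refine permutes_of_subset ?_
  rintro _ ⟨b, hb, a, ha, rfl⟩
  have hmem : f b * f a ∈ (B.map f : Set G') * A.map f :=
    Set.mul_mem_mul (Subgroup.mem_map_of_mem f hb) (Subgroup.mem_map_of_mem f ha)
  rw [← h] at hmem
  obtain ⟨_, ⟨a', ha', rfl⟩, _, ⟨b', hb', rfl⟩, heq : f a' * f b' = f b * f a⟩ := hmem
  have hquot : b * a * (a' * b')⁻¹ ∈ f.ker := by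
    rw [MonoidHom.mem_ker, map_mul, map_inv, map_mul, map_mul, heq, mul_inv_cancel]
  exact ⟨b * a * (a' * b')⁻¹ * a', A.mul_mem (hker hquot) ha', b', hb', by group⟩

theorem ResidualConditions.permutesHalls [Finite G] (hσ : IsPrimePartition σ)
    (h : ResidualConditions σ G) (hA : IsSigmaSubnormal σ A) : PermutesHalls σ A := by
  have := h.normal_of_le _ (inf_le_right : A ⊓ sigmaCommutator σ G ≤ _)
  have hf := QuotientGroup.mk'_surjective (A ⊓ sigmaCommutator σ G)
  have hker := QuotientGroup.ker_mk' (A ⊓ sigmaCommutator σ G)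
  intro i H hH
  exact .of_map (hker.trans_le inf_le_left)
    ((h.of_surjective hσ hf).permutesHalls_of_inf_eq_bot hσ (hA.map_of_surjective hf)
      (map_sigmaCommutator (σ := σ) hf ▸ map_inf_map_eq_bot hker) i _ (hH.map hf))

end SubnormalPermutability

section Converse

variable {I : Type v} {σ : I → Set ℕ} {G : Type u} [Group G] {A : Subgroup G}
  {τ : SubgroupSystem.{u}}

theorem IsSigmaSubnormal.piGenerated (h : IsSigmaSubnormal σ A) (π : Set ℕ) :
    IsSigmaSubnormal σ (piGenerated π A) :=
  h.of_le_normalizer piGenerated_le_self (le_normalizer_piGenerated Subgroup.le_normalizer)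

theorem IsSigmaSpecial.mem_of_piGenerated_mem [Finite G] (hσ : IsPrimePartition σ)
    (hτ : IsSigmaSpecial σ τ) (hG : IsSigmaFull σ G) (hA : IsSigmaSubnormal σ A)
    (h : ∀ i, piGenerated (σ i) A ∈ τ G) : A ∈ τ G := by
  classical
  obtain ⟨j, -⟩ := hσ.exists_mem Nat.prime_two
  have hfin : ∀ F : Finset I, piGenerated (σ j ∪ ⋃ i ∈ F, σ i) A ∈ τ G := by
    intro F
    induction F using Finset.induction_on with
    | empty => simpa only [Finset.notMem_empty, Set.iUnion_of_empty, Set.iUnion_empty,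
        Set.union_empty] using h j
    | insert i F _ ih =>
      rw [Finset.set_biUnion_insert, Set.union_left_comm, piGenerated_union]
      exact hτ.sup_mem G hG _ _ (hA.piGenerated _) (hA.piGenerated _) (h i) ih
  have hpi : IsPiGroup (σ j ∪ ⋃ i ∈ (hσ.finite_memSigma A).toFinset, σ i) A := by
    intro p hp hd
    obtain ⟨i, hi⟩ := hσ.exists_mem hp
    exact Or.inr (Set.mem_biUnion ((hσ.finite_memSigma A).mem_toFinset.2 ⟨p, hi, hd⟩) hi)
  rw [← piGenerated_le_self.antisymm (IsPiGroup.le_piGenerated hpi le_rfl)]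
  exact hfin _

theorem ResidualConditions.mem_of_isSigmaPrimary [Finite G] (hσ : IsPrimePartition σ)
    (hτ : IsSigmaSpecial σ τ) (hG : IsSigmaSoluble σ G) (h : ResidualConditions σ G)
    (hU : ∀ U : Subgroup G, sigmaCommutator σ G ≤ U → U ∈ τ G) {M : Subgroup G}
    (hM : Subgroup.IsComplement' (sigmaCommutator σ G) M) {B : Subgroup G} (hBM : B ≤ M)
    (hB : IsSigmaSubnormal σ B) (hprim : IsSigmaPrimary σ B) : B ∈ τ G := by
  have hS := hG.hasSigmaSeries
  have hF := hS.isSigmaFull hσ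
  have hsemi : IsSemidirect (sigmaNilpotentResidual σ G) M := by
    rw [sigmaNilpotentResidual_eq hσ]
    exact ⟨inferInstance, hM⟩
  obtain ⟨B, rfl⟩ : ∃ B' : Subgroup M, B'.map M.subtype = B :=
    ⟨B.subgroupOf M, Subgroup.map_subgroupOf_eq_of_le hBM⟩
  refine hτ.lift_mem G hF hG
    (isPSigmaTGroup_of_permutesHalls hσ hS fun A hA => h.permutesHalls hσ hA) M hsemi B ?_ hB
    (mem_of_isComplement' hτ.toIsSubgroupFunctor hM hF ((hS.subgroup M).isSigmaFull hσ) hU B)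
  refine hprim.imp fun i hi => ?_
  rwa [IsPiGroup, Subgroup.card_map_of_injective M.subtype_injective] at hi

theorem ResidualConditions.mem_of_inf_eq_bot [Finite G] (hσ : IsPrimePartition σ)
    (hτ : IsSigmaSpecial σ τ) (hG : IsSigmaSoluble σ G) (h : ResidualConditions σ G)
    (hU : ∀ U : Subgroup G, sigmaCommutator σ G ≤ U → U ∈ τ G) (hA : IsSigmaSubnormal σ A)
    (hAD : A ⊓ sigmaCommutator σ G = ⊥) : A ∈ τ G := by
  obtain ⟨M, hM⟩ := Subgroup.exists_right_complement'_of_coprime h.coprime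
  refine hτ.mem_of_piGenerated_mem hσ (hG.hasSigmaSeries.isSigmaFull hσ) hA fun i => ?_
  refine h.mem_of_isSigmaPrimary hσ hτ hG hU hM ?_ (hA.piGenerated _) ⟨i, ?_⟩
  · exact piGenerated_le fun p hp _ x hx hxp =>
      h.mem_of_mem_sup hσ hA hAD hp hx hxp (hM.sup_eq_top ▸ Subgroup.mem_top x)
  · exact SigmaTheory.isPiGroup_piGenerated fun p q _ hq hpi hqi x hx y _ hxp hyq =>
      (h.commute_of_areSeparated hσ hA hAD (hσ.areSeparated hpi hq hqi) hx hxp hyq).symm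

theorem ResidualConditions.mem [Finite G] (hσ : IsPrimePartition σ)
    (hτ : IsSigmaSpecial σ τ) (hG : IsSigmaSoluble σ G) (h : ResidualConditions σ G)
    (hU : ∀ U : Subgroup G, sigmaCommutator σ G ≤ U → U ∈ τ G) (hA : IsSigmaSubnormal σ A) :
    A ∈ τ G := by
  have := h.normal_of_le _ (inf_le_right : A ⊓ sigmaCommutator σ G ≤ _)
  have hf := QuotientGroup.mk'_surjective (A ⊓ sigmaCommutator σ G)
  have hker := QuotientGroup.ker_mk' (A ⊓ sigmaCommutator σ G)
  have hG' := hG.of_surjective hf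
  have hF := hG.hasSigmaSeries.isSigmaFull hσ
  have hF' := hG'.hasSigmaSeries.isSigmaFull hσ
  have hU' : ∀ U, sigmaCommutator σ (G ⧸ A ⊓ sigmaCommutator σ G) ≤ U → U ∈ τ _ := by
    intro U hDU
    rw [← Subgroup.map_comap_eq_self_of_surjective hf U]
    refine hτ.map_mem _ _ hF hF' _ hf _ (hU _ ?_)
    rwa [← Subgroup.map_le_iff_le_comap, map_sigmaCommutator hf]
  rw [← Subgroup.comap_map_eq_self (hker.trans_le inf_le_left)]
  exact hτ.comap_mem _ _ hF hF' _ hf _ ((h.of_surjective hσ hf).mem_of_inf_eq_bot hσ hτ hG' hU'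
    (hA.map_of_surjective hf) (map_sigmaCommutator (σ := σ) hf ▸ map_inf_map_eq_bot hker))

theorem HasNormalComplementIn.commute {O H : Subgroup G} [O.Normal]
    (h : HasNormalComplementIn O H) (hO : ∀ x ∈ O, ∀ y ∈ O, Commute x y) {x y : G} (hx : x ∈ O)
    (hy : y ∈ H) : Commute x y := by
  obtain ⟨hOH, S, hS, hSO⟩ := h
  have hyS : (⟨y, hy⟩ : H) ∈ ((S ⊔ O.subgroupOf H : Subgroup H) : Set H) :=
    hSO.sup_eq_top ▸ Subgroup.mem_top _
  rw [Subgroup.normal_mul] at hyS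
  obtain ⟨s, hs, o, ho, hso : s * o = ⟨y, hy⟩⟩ := hyS
  have hxs : Commute (⟨x, hOH hx⟩ : H) s :=
    (Subgroup.commute_of_normal_of_disjoint S (O.subgroupOf H) hS inferInstance hSO.disjoint s _ hs
      hx).symm
  have hxo : Commute (⟨x, hOH hx⟩ : H) o := Subtype.ext (hO x hx o ho)
  exact congrArg Subtype.val (hso ▸ hxs.mul_right hxo).eq

theorem normal_of_isPowerAutomorphism_conjNormal {D : Subgroup G} [D.Normal]
    (h : ∀ g : G, IsPowerAutomorphism (MulAut.conjNormal g : MulAut D)) {K : Subgroup G}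
    (hK : K ≤ D) : K.Normal := by
  refine ⟨fun x hx g => ?_⟩
  have hmem : (MulAut.conjNormal g : MulAut D) ⟨x, hK hx⟩ ∈ K.subgroupOf D :=
    h g (K.subgroupOf D) ▸ Subgroup.mem_map_of_mem _ (Subgroup.mem_subgroupOf.2 hx)
  rwa [Subgroup.mem_subgroupOf, MulAut.conjNormal_apply] at hmem

theorem StructureConditions.residualConditions [Finite G] (hσ : IsPrimePartition σ)
    {M : Subgroup G} (h : StructureConditions σ τ (sigmaCommutator σ G) M) :
    ResidualConditions σ G where
  comm := h.abelian
  hall _ hp hd hi := hp.one_lt.ne' (Nat.eq_one_of_dvd_coprimes h.hall hd hi)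
  normal_of_le _ hK := normal_of_isPowerAutomorphism_conjNormal h.power hK
  commute i p r hp hr x hx hxp z hz := by
    obtain ⟨H, hH, hcompl⟩ := h.complement i
    rw [map_piCore_eq h.abelian] at hcompl
    obtain ⟨g, hg⟩ := hH.exists_conj_mem (hσ.prime hr) hr hz
    have hO := normal_of_isPowerAutomorphism_conjNormal h.power
      (piGenerated_le_self (π := σ i) (K := sigmaCommutator σ G))
    have hxO := hO.conj_mem x (mem_piGenerated (hσ.prime hp) hp hx hxp) g⁻¹
    have hcomm := (Commute.conj_iff g).2 (hcompl.commute (fun x hx y hy =>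
      h.abelian x (piGenerated_le_self hx) y (piGenerated_le_self hy)) hxO hg)
    simpa only [mul_assoc, inv_inv, mul_inv_cancel_left, mul_inv_cancel, mul_one] using hcomm

theorem StructureConditions.mem_of_sigmaCommutator_le [Finite G] (hσ : IsPrimePartition σ)
    (hτ : IsSubgroupFunctor σ τ) (hG : IsSigmaSoluble σ G) {M : Subgroup G}
    (h : StructureConditions σ τ (sigmaCommutator σ G) M) {U : Subgroup G}
    (hU : sigmaCommutator σ G ≤ U) : U ∈ τ G := by
  obtain ⟨φ, hφ, hker⟩ := exists_retraction h.semidirect.2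
  rw [← Subgroup.comap_map_eq_self (hker.trans_le hU)]
  exact hτ.comap_mem G M (hG.hasSigmaSeries.isSigmaFull hσ)
    ((hG.hasSigmaSeries.subgroup M).isSigmaFull hσ) φ hφ _ (h.mem _)

end Converse

end SigmaTheory

theorem theorem2p11 {I : Type v} (σ : I → Set ℕ) (hσ : IsPrimePartition σ)
    (τ : SubgroupSystem.{u}) (hτ : IsSigmaSpecial σ τ)
    (G : Type u) [Group G] [Finite G] (hG : IsSigmaSoluble σ G) :
    ((∀ A : Subgroup G, IsSigmaSubnormal σ A → A ∈ τ G) →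
      IsPSigmaTGroup σ G ∧
        ∃ M : Subgroup G, StructureConditions σ τ (sigmaNilpotentResidual σ G) M) ∧
    ((∃ M : Subgroup G, StructureConditions σ τ (sigmaNilpotentResidual σ G) M) →
      ∀ A : Subgroup G, IsSigmaSubnormal σ A → A ∈ τ G) := by
  rw [sigmaNilpotentResidual_eq hσ]
  refine ⟨exists_structureConditions hσ hτ hG, ?_⟩
  rintro ⟨M, hM⟩ A hA
  exact (hM.residualConditions hσ).mem hσ hτ hG
    (fun U hU => hM.mem_of_sigmaCommutator_le hσ hτ.toIsSubgroupFunctor hG hU) hA
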